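/- Let $d\ge 1$, let $D\subset\mathbb R^d$ be a bounded connected nonempty open set with $C^\infty$ boundary, and let $\alpha\in(0,d)$. All functions are real-valued. For $s\ge 0$ let $W^{s,2}(\mathbb R^d)$ be the space of tempered distributions $f$ whose Fourier transform is a locally integrable function with $\|f\|_{W^{s,2}(\mathbb R^d)}^2=\int_{\mathbb R^d}(1+|\xi|^2)^s|\mathcal Ff(\xi)|^2\,d\xi<\infty$ (for $s\ge0$ these are $L^2$ functions). Let $W^{s,2}(D)$ be the space of restrictions to $D$ of functions in $W^{s,2}(\mathbb R^d)$, with norm $\|f\|_{W^{s,2}(D)}=\inf\{\|g\|_{W^{s,2}(\mathbb R^d)}: g|_D=f\}$, and let $W_0^{-s,2}(D)$ be its topological dual with the dual norm. A function $\varphi\in L^2(D)$, in particular $\varphi\in C_c^\infty(D)$, is regarded as the element $f\mapsto\int_D\varphi f$ of $W_0^{-s,2}(D)$. Let $X$ be a log-correlated field on $D$, that is, a centered Gaussian random field with values in the distributions on $D$ and with covariance kernel $R(y,z)=\log\frac1{|z-y|}+g(z,y)$, where $g(z,y)=h(z-y)$ for a smooth function $h:\mathbb R^d\to\mathbb R$;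 this means $\mathbb E[\langle X,\psi_1\rangle\langle X,\psi_2\rangle]=\int_D\int_D R(y,z)\psi_1(y)\psi_2(z)\,dz\,dy$ for all $\psi_1,\psi_2\in C_c^\infty(D)$. For $0<\gamma<d$ put $$G_\gamma\varphi(z)=\int_D e^{\gamma R(z,y)}\varphi(y)\,dy=\int_D|z-y|^{-\gamma}e^{\gamma g(z,y)}\varphi(y)\,dy .$$ For $\beta\in(0,\sqrt d)$ the field is called $\beta$-non-degenerate on $D$ if there is a constant $c_0>0$ such that $\int_D\psi(z)\,G_{\beta^2}\psi(z)\,dz\ge c_0\|\psi\|^2_{W_0^{-(d-\beta^2)/2,2}(D)}$ for all $\psi\in C_c^\infty(D)$. Assume that $X$ is $\beta$-non-degenerate on $D$ with $\beta=\sqrt\alpha$. Then $G_\alpha$ extends to a bounded linear bijection $$T: W_0^{-\frac{d-\alpha}2,2}(D)\to W^{\frac{d-\alpha}2,2}(D).$$ Precisely, there is a bijective bounded linear map $T$ between these spaces such that $T\varphi=G_\alpha\varphi$ almost everywhere on $D$ for every $\varphi\in L^2(D)$, and $T$ is the only bounded linear map between these spaces which agrees with $G_\alpha$ on $C_c^\infty(D)$.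 -/

import Mathlib

open MeasureTheory TopologicalSpace ProbabilityTheory
open scoped NNReal ENNReal ContDiff Distributions FourierTransform

noncomputable section

/-- The Euclidean space `ℝ^d`. -/
abbrev Space (d : ℕ) : Type := EuclideanSpace ℝ (Fin d)

/-! ### Domains -/

/-- A bounded domain with smooth boundary: a bounded nonempty connected open set which near each
of its boundary points is the sublevel set `{ρ < 0}` of a smooth function `ρ` with non-vanishing
differential at that point. -/
structure IsSmoothBoundedDomain {d : ℕ} (D : Opens (Space d)) : Prop where
  isConnected : IsConnected (D : Set (Space d))
  isBounded : Bornology.IsBounded (D : Set (Space d))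
  smooth_boundary : ∀ x ∈ frontier (D : Set (Space d)),
    ∃ (U : Set (Space d)) (ρ : Space d → ℝ), IsOpen U ∧ x ∈ U ∧ ContDiffOn ℝ ∞ ρ U ∧
      fderiv ℝ ρ x ≠ 0 ∧ (D : Set (Space d)) ∩ U = {y ∈ U | ρ y < 0}

/-! ### The Sobolev space `W^{s,2}(ℝ^d)`, `s ≥ 0` -/

/-- The Fourier transform of a real-valued function in `L²(ℝ^d)`. -/
def realFourier (d : ℕ) :
    Lp ℝ 2 (volume : Measure (Space d)) →ₗ[ℝ] Lp ℂ 2 (volume : Measure (Space d)) where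
  toFun f := 𝓕 (Complex.ofRealCLM.compLpL 2 (volume : Measure (Space d)) f)
  map_add' f g := by rw [map_add, FourierTransform.fourier_add]
  map_smul' c f := by
    rw [map_smul, RingHom.id_apply]
    have h : ∀ u : Lp ℂ 2 (volume : Measure (Space d)), c • u = (c : ℂ) • u :=
      fun u ↦ (Complex.coe_smul c u).symm
    rw [h, h, FourierTransform.fourier_smul]

theorem norm_realFourier {d : ℕ} (f : Lp ℝ 2 (volume : Measure (Space d))) :
    ‖realFourier d f‖ = ‖f‖ := by
  change ‖𝓕 (Complex.ofRealCLM.compLpL 2 (volume : Measure (Space d)) f)‖ = ‖f‖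
  rw [Lp.norm_fourier_eq]
  refine le_antisymm (Lp.norm_le_norm_of_ae_le ?_) (Lp.norm_le_norm_of_ae_le ?_) <;>
    filter_upwards [Complex.ofRealCLM.coeFn_compLpL (p := 2) f] with x hx <;> simp [hx]

/-- The function `ξ ↦ (1 + |ξ|²)^{s/2} 𝓕f(ξ)`. -/
def weightedFourier (d : ℕ) (s : ℝ≥0) (f : Lp ℝ 2 (volume : Measure (Space d))) :
    Space d → ℂ :=
  fun ξ ↦ ((1 + ‖ξ‖ ^ 2) ^ ((s : ℝ) / 2) : ℝ) • realFourier d f ξ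

theorem weightedFourier_add {d : ℕ} (s : ℝ≥0) (f g : Lp ℝ 2 (volume : Measure (Space d))) :
    weightedFourier d s (f + g) =ᵐ[volume] weightedFourier d s f + weightedFourier d s g := by
  have h := Lp.coeFn_add (realFourier d f) (realFourier d g)
  rw [← map_add] at h
  filter_upwards [h] with ξ hξ
  simp only [weightedFourier, Pi.add_apply, hξ, smul_add]

theorem weightedFourier_smul {d : ℕ} (s : ℝ≥0) (c : ℝ)
    (f : Lp ℝ 2 (volume : Measure (Space d))) :
    weightedFourier d s (c • f) =ᵐ[volume] c • weightedFourier d s f := by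
  have h := Lp.coeFn_smul c (realFourier d f)
  rw [← map_smul] at h
  filter_upwards [h] with ξ hξ
  simp only [weightedFourier, Pi.smul_apply, hξ]
  rw [smul_comm]

/-- The real-valued `f ∈ L²(ℝ^d)` with `∫ (1 + |ξ|²)^s |𝓕f(ξ)|² dξ < ∞`. As `s ≥ 0`, every tempered
distribution whose Fourier transform is a function satisfying this bound is an `L²` function. -/
def sobolevSubmodule (d : ℕ) (s : ℝ≥0) :
    Submodule ℝ (Lp ℝ 2 (volume : Measure (Space d))) where
  carrier := {f | MemLp (weightedFourier d s f) 2 volume}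
  add_mem' {f g} hf hg := (memLp_congr_ae (weightedFourier_add s f g)).2 (hf.add hg)
  zero_mem' := by
    have h : weightedFourier d s 0 =ᵐ[volume] 0 := by
      have h0 := weightedFourier_smul (d := d) s 0 0
      rwa [zero_smul, zero_smul] at h0
    exact (memLp_congr_ae h).2 MemLp.zero
  smul_mem' c f hf := (memLp_congr_ae (weightedFourier_smul s c f)).2 (hf.const_smul c)

/-- The space `W^{s,2}(ℝ^d)` of real-valued functions, `s ≥ 0`. -/
def SobolevSpace (d : ℕ) (s : ℝ≥0) : Type := sobolevSubmodule d s

namespace SobolevSpace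

variable {d : ℕ} {s : ℝ≥0}

instance : AddCommGroup (SobolevSpace d s) := inferInstanceAs (AddCommGroup (sobolevSubmodule d s))

instance : Module ℝ (SobolevSpace d s) := inferInstanceAs (Module ℝ (sobolevSubmodule d s))

/-- The underlying `L²` function of an element of `W^{s,2}(ℝ^d)`, as a linear map. -/
def toL2Lin (d : ℕ) (s : ℝ≥0) :
    SobolevSpace d s →ₗ[ℝ] Lp ℝ 2 (volume : Measure (Space d)) :=
  (sobolevSubmodule d s).subtype

theorem memLp_weightedFourier (f : SobolevSpace d s) :
    MemLp (weightedFourier d s (toL2Lin d s f)) 2 volume := f.2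

/-- The map `f ↦ (1 + |ξ|²)^{s/2} 𝓕f` from `W^{s,2}(ℝ^d)` into `L²(ℝ^d)`. -/
def toWeighted (d : ℕ) (s : ℝ≥0) :
    SobolevSpace d s →ₗ[ℝ] Lp ℂ 2 (volume : Measure (Space d)) where
  toFun f := (memLp_weightedFourier f).toLp _
  map_add' f g := by
    rw [← MemLp.toLp_add]
    refine MemLp.toLp_congr _ _ ?_
    rw [map_add]
    exact weightedFourier_add s _ _
  map_smul' c f := by
    rw [RingHom.id_apply, ← MemLp.toLp_const_smul]
    refine MemLp.toLp_congr _ _ ?_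
    rw [map_smul]
    exact weightedFourier_smul s c _

theorem norm_toL2Lin_le (f : SobolevSpace d s) : ‖toL2Lin d s f‖ ≤ ‖toWeighted d s f‖ := by
  rw [← norm_realFourier]
  refine Lp.norm_le_norm_of_ae_le ?_
  filter_upwards [(memLp_weightedFourier f).coeFn_toLp] with ξ hξ
  change _ ≤ ‖((memLp_weightedFourier f).toLp _ : Space d → ℂ) ξ‖
  have h1 : (1 : ℝ) ≤ (1 + ‖ξ‖ ^ 2) ^ ((s : ℝ) / 2) :=
    Real.one_le_rpow (by nlinarith [sq_nonneg ‖ξ‖]) (by positivity)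
  rw [hξ, weightedFourier, norm_smul, Real.norm_of_nonneg (by linarith)]
  exact le_mul_of_one_le_left (norm_nonneg _) h1

theorem toWeighted_injective : Function.Injective (toWeighted d s) := by
  refine (injective_iff_map_eq_zero _).2 fun f hf ↦ ?_
  have h := norm_toL2Lin_le f
  rw [hf, norm_zero] at h
  exact Subtype.ext (norm_le_zero_iff.1 h)

/-- The norm of `W^{s,2}(ℝ^d)` is `(∫ (1 + |ξ|²)^s |𝓕f(ξ)|² dξ)^{1/2}`. -/
instance : NormedAddCommGroup (SobolevSpace d s) :=
  NormedAddCommGroup.induced _ _ (toWeighted d s) toWeighted_injective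

instance : NormedSpace ℝ (SobolevSpace d s) := NormedSpace.induced ℝ _ _ (toWeighted d s)

theorem norm_def (f : SobolevSpace d s) : ‖f‖ = ‖toWeighted d s f‖ := rfl

/-- The inclusion of `W^{s,2}(ℝ^d)` in `L²(ℝ^d)`. -/
def toL2 (d : ℕ) (s : ℝ≥0) :
    SobolevSpace d s →L[ℝ] Lp ℝ 2 (volume : Measure (Space d)) :=
  (toL2Lin d s).mkContinuous 1 fun f ↦ by rw [one_mul]; exact norm_toL2Lin_le f

end SobolevSpace

/-! ### The Sobolev space `W^{s,2}(D)`, `s ≥ 0`, and its dual `W_0^{-s,2}(D)` -/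

/-- Restriction to `D` of the functions in `W^{s,2}(ℝ^d)`. -/
def sobolevRestrict {d : ℕ} (D : Opens (Space d)) (s : ℝ≥0) :
    SobolevSpace d s →L[ℝ] Lp ℝ 2 (volume.restrict (D : Set (Space d))) :=
  (LpToLpRestrictCLM (Space d) ℝ ℝ volume 2 (D : Set (Space d))).comp (SobolevSpace.toL2 d s)

/-- The functions in `W^{s,2}(ℝ^d)` that vanish almost everywhere on `D`. -/
def vanishingOn {d : ℕ} (D : Opens (Space d)) (s : ℝ≥0) : Submodule ℝ (SobolevSpace d s) :=
  (sobolevRestrict D s).ker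

instance {d : ℕ} (D : Opens (Space d)) (s : ℝ≥0) :
    IsClosed (vanishingOn D s : Set (SobolevSpace d s)) :=
  (sobolevRestrict D s).isClosed_ker

/-- The space `W^{s,2}(D)` of restrictions to `D` of functions in `W^{s,2}(ℝ^d)`: two functions
have the same restriction when they differ by a function vanishing on `D`. The quotient norm is
`‖f‖ = inf {‖g‖ : g ∈ W^{s,2}(ℝ^d), g|_D = f}`. -/
abbrev SobolevOn {d : ℕ} (D : Opens (Space d)) (s : ℝ≥0) : Type :=
  SobolevSpace d s ⧸ vanishingOn D s

/-- An element of `W^{s,2}(D)` as an (almost everywhere defined) function on `D`. -/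
def SobolevOn.toL2 {d : ℕ} (D : Opens (Space d)) (s : ℝ≥0) :
    SobolevOn D s →L[ℝ] Lp ℝ 2 (volume.restrict (D : Set (Space d))) :=
  (vanishingOn D s).liftQL (sobolevRestrict D s) le_rfl

/-- The topological dual `W_0^{-s,2}(D)` of `W^{s,2}(D)`, with the dual norm. -/
abbrev SobolevDual {d : ℕ} (D : Opens (Space d)) (s : ℝ≥0) : Type :=
  StrongDual ℝ (SobolevOn D s)

/-- A function `φ ∈ L²(D)` as an element of `W_0^{-s,2}(D)`, acting by `f ↦ ∫_D φ f`. -/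
def L2ToDual {d : ℕ} (D : Opens (Space d)) (s : ℝ≥0)
    (φ : Lp ℝ 2 (volume.restrict (D : Set (Space d)))) : SobolevDual D s :=
  (innerSL ℝ φ).comp (SobolevOn.toL2 D s)

theorem L2ToDual_apply {d : ℕ} (D : Opens (Space d)) (s : ℝ≥0)
    (φ : Lp ℝ 2 (volume.restrict (D : Set (Space d)))) (f : SobolevOn D s) :
    L2ToDual D s φ f = ∫ z in (D : Set (Space d)), φ z * SobolevOn.toL2 D s f z := by
  simp only [L2ToDual, ContinuousLinearMap.comp_apply, innerSL_apply_apply, L2.inner_def]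
  refine integral_congr_ae (Filter.Eventually.of_forall fun z ↦ ?_)
  simp [mul_comm]

/-- A test function `ψ ∈ C_c^∞(D)` as an element of `L²(D)`. -/
def testToL2 {d : ℕ} (D : Opens (Space d)) (ψ : 𝓓(D, ℝ)) :
    Lp ℝ 2 (volume.restrict (D : Set (Space d))) :=
  (ψ.continuous.memLp_of_hasCompactSupport (p := 2)
    (μ := volume.restrict (D : Set (Space d))) ψ.hasCompactSupport).toLp ψ

/-! ### Log-correlated fields and the potential operator -/

/-- A distribution-valued random field `X` on `D` is a centered Gaussian log-correlated field
with covariance kernel `R(y, z) = log (1 / |z - y|) + h(z - y)`, `h` smooth. -/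
structure IsLogCorrelatedField {d : ℕ} (D : Opens (Space d)) {Ω : Type*} [MeasurableSpace Ω]
    (P : Measure Ω) (X : Ω → 𝓓'(D, ℝ)) (h : Space d → ℝ) : Prop where
  smooth : ContDiff ℝ ∞ h
  gaussian : IsGaussianProcess (fun (ψ : 𝓓(D, ℝ)) (w : Ω) ↦ X w ψ) P
  centered : ∀ ψ : 𝓓(D, ℝ), ∫ w, X w ψ ∂P = 0
  covariance : ∀ ψ₁ ψ₂ : 𝓓(D, ℝ),
    ∫ w, X w ψ₁ * X w ψ₂ ∂P =
      ∫ y in (D : Set (Space d)), ∫ z in (D : Set (Space d)),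
        (Real.log (1 / ‖z - y‖) + h (z - y)) * ψ₁ y * ψ₂ z

/-- The potential operator
`G_α φ(z) = ∫_D exp (α R(z, y)) φ(y) dy = ∫_D |z - y|^{-α} e^{α h(z - y)} φ(y) dy` attached to the
covariance kernel `R(z, y) = log (1 / |z - y|) + h(z - y)`. -/
def potential {d : ℕ} (D : Opens (Space d)) (h : Space d → ℝ) (α : ℝ) (φ : Space d → ℝ)
    (z : Space d) : ℝ :=
  ∫ y in (D : Set (Space d)), ‖z - y‖ ^ (-α) * Real.exp (α * h (z - y)) * φ y

/-- The order `s = (d - γ) / 2`, for `0 < γ < d`. -/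
def sobolevOrder (d : ℕ) (γ : ℝ) : ℝ≥0 := Real.toNNReal ((d - γ) / 2)

/-- `β`-non-degeneracy on `D` of the field with covariance `log (1 / |z - y|) + h(z - y)`: with
`s = (d - β²) / 2` there is `c₀ > 0` such that `∫_D ψ G_{β²} ψ ≥ c₀ ‖ψ‖²_{W_0^{-s,2}(D)}` for every
`ψ ∈ C_c^∞(D)`. -/
def IsNonDegenerate {d : ℕ} (D : Opens (Space d)) (h : Space d → ℝ) (β : ℝ) : Prop :=
  ∃ c₀ : ℝ, 0 < c₀ ∧ ∀ ψ : 𝓓(D, ℝ),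
    c₀ * ‖L2ToDual D (sobolevOrder d (β ^ 2)) (testToL2 D ψ)‖ ^ 2 ≤
      ∫ z in (D : Set (Space d)), ψ z * potential D h (β ^ 2) ψ z

end

/-!
The reason for the result is that `G_α` is, up to restriction to `D`, a convolution operator whose
symbol has order `-2s`, `s = (d - α) / 2`, and is coercive by non-degeneracy.

*Boundedness.* As `D` is bounded, only the values of the kernel `|x|^{-α} e^{α h(x)}` on the bounded
set `D - D` matter, so that it can be multiplied by a cutoff function (`exists_kernel`). The Fourier
transform `κ` of a kernel `|x|^{-α} η(x)`, with `η` a Schwartz function, is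
`O((1 + |ξ|²)^{-(d - α) / 2})` (`exists_norm_fourier_riesz_mul_le`): writing `|x|^{-α}` as a
superposition of the Gaussians `e^{-t|x|²}` bounds `κ` by the Riesz potential
`∫ |ξ + ζ|^{-(d - α)} |𝓕⁻η(ζ)| dζ`, and the decay of `𝓕⁻η` allows the weight
`(1 + |ξ|²)^{(d - α) / 2}` to be distributed between the two factors. A functional on `W^{s,2}(D)`
is represented by an element of the Hilbert space `W^{s,2}(ℝ^d)` (`rieszRepr`); the representative
of `φ ∈ L²(D)` has spectrum `(1 + |ξ|²)^{-s} 𝓕φ(ξ)`. Multiplying the spectrum by the bounded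
function `(1 + |ξ|²)^s κ` produces the spectrum `κ 𝓕φ` of the convolution of the kernel with `φ`,
whose restriction to `D` is `G_α φ` (`exists_potentialOperator`).

*Density.* Test functions are dense in `W_0^{-s,2}(D)`, because the predual `W^{s,2}(D)` is a
Hilbert space and a function annihilated by all test functions vanishes on `D`
(`denseRange_testToDual`). This gives the uniqueness of the extension, and spreads the
non-degeneracy bound `c₀ ‖ℓ‖² ≤ ℓ (T ℓ)` from test functions to all `ℓ`.

*Bijectivity.* A coercive operator from the dual of a normed space to that space is bijective
(`bijective_of_coercive`).
-/

/-! ### The Fourier transform on `L²` and the Fourier integral -/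

section FourierL2

open SchwartzMap

variable {E : Type*} [NormedAddCommGroup E] [InnerProductSpace ℝ E] [FiniteDimensional ℝ E]
  [MeasurableSpace E] [BorelSpace E]

/-- Locally integrable functions are determined by their integrals against Schwartz functions. -/
theorem ae_eq_of_integral_schwartz_mul_eq {u v : E → ℂ} (hu : LocallyIntegrable u)
    (hv : LocallyIntegrable v) (h : ∀ g : 𝓢(E, ℂ), ∫ x, g x * u x = ∫ x, g x * v x) :
    u =ᵐ[volume] v := by
  refine ae_eq_of_integral_contDiff_smul_eq hu hv fun g hg hgc ↦ ?_
  have hg₁ : HasCompactSupport (Complex.ofRealCLM ∘ g) := hgc.comp_left rfl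
  have hg₂ : ContDiff ℝ ∞ (Complex.ofRealCLM ∘ g) := by fun_prop
  simpa using h (hg₁.toSchwartzMap hg₂)

/-- The defining property of the Fourier transform on tempered distributions, for `u ∈ L²`. -/
theorem integral_schwartz_mul_fourier (u : Lp ℂ 2 (volume : Measure E)) (g : 𝓢(E, ℂ)) :
    ∫ x, g x * (𝓕 u : Lp ℂ 2 (volume : Measure E)) x = ∫ x, (𝓕 g) x * u x := by
  have h := DFunLike.congr_fun (Lp.fourier_toTemperedDistribution_eq u) g
  simpa [TemperedDistribution.fourier_apply, Lp.toTemperedDistribution_apply] using h.symm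

theorem integral_schwartz_mul_fourierIntegral {v : E → ℂ} (hv : Integrable v) (g : 𝓢(E, ℂ)) :
    ∫ x, g x * (𝓕 v) x = ∫ x, (𝓕 g) x * v x := by
  have h := VectorFourier.integral_fourierIntegral_smul_eq_flip (L := innerₗ E)
    Real.continuous_fourierChar continuous_inner
    (g.integrable (μ := volume)) hv
  rw [flip_innerₗ] at h
  exact h.symm

theorem continuous_fourierIntegral {v : E → ℂ} (hv : Integrable v) : Continuous (𝓕 v) :=
  VectorFourier.fourierIntegral_continuous Real.continuous_fourierChar continuous_inner hv

/-- The `L²` Fourier transform is given by the Fourier integral on `L¹ ∩ L²`. -/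
theorem coeFn_fourier_toLp {v : E → ℂ} (hv : Integrable v) (hv2 : MemLp v 2) :
    (𝓕 (hv2.toLp v) : Lp ℂ 2 (volume : Measure E)) =ᵐ[volume] 𝓕 v := by
  refine ae_eq_of_integral_schwartz_mul_eq ((Lp.memLp _).locallyIntegrable (by norm_num))
    (continuous_fourierIntegral hv).locallyIntegrable fun g ↦ ?_
  rw [integral_schwartz_mul_fourier, integral_schwartz_mul_fourierIntegral hv]
  refine integral_congr_ae ?_
  filter_upwards [hv2.coeFn_toLp] with x hx using by rw [hx]

/-- Injectivity of the Fourier transform, between a function in `L²` and one in `L¹`. -/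
theorem ae_eq_of_fourier_ae_eq {u : Lp ℂ 2 (volume : Measure E)} {v : E → ℂ} (hv : Integrable v)
    (h : (𝓕 u : Lp ℂ 2 (volume : Measure E)) =ᵐ[volume] 𝓕 v) : u =ᵐ[volume] v := by
  refine ae_eq_of_integral_schwartz_mul_eq ((Lp.memLp _).locallyIntegrable (by norm_num))
    hv.locallyIntegrable fun g ↦ ?_
  have h1 := integral_schwartz_mul_fourier u (𝓕⁻ g)
  have h2 := integral_schwartz_mul_fourierIntegral hv (𝓕⁻ g)
  rw [FourierTransform.fourier_fourierInv_eq] at h1 h2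
  rw [← h1, ← h2]
  refine integral_congr_ae ?_
  filter_upwards [h] with x hx using by rw [hx]

theorem fourierIntegral_neg_of_real {v : E → ℂ} (hv : ∀ x, (starRingEnd ℂ) (v x) = v x) (ξ : E) :
    𝓕 v (-ξ) = (starRingEnd ℂ) (𝓕 v ξ) := by
  rw [Real.fourier_eq', Real.fourier_eq', ← integral_conj]
  refine integral_congr_ae (.of_forall fun x ↦ ?_)
  simp only [smul_eq_mul, map_mul, hv, ← Complex.exp_conj]
  congr 2
  simp [Complex.ext_iff]

/-- A function in `L²` whose Fourier transform `w` satisfies `w(-ξ) = conj (w(ξ))` is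
real-valued. -/
theorem im_ae_eq_zero_of_fourier_neg {u : Lp ℂ 2 (volume : Measure E)} {w : E → ℂ}
    (hw : (𝓕 u : Lp ℂ 2 (volume : Measure E)) =ᵐ[volume] w)
    (hsymm : ∀ ξ, w (-ξ) = (starRingEnd ℂ) (w ξ)) : ∀ᵐ x, (u x).im = 0 := by
  have hu : LocallyIntegrable u := (Lp.memLp u).locallyIntegrable (by norm_num)
  refine ae_eq_zero_of_integral_contDiff_smul_eq_zero
    (hu.mono (Complex.continuous_im.comp_aestronglyMeasurable (Lp.aestronglyMeasurable u))
      (.of_forall fun x ↦ by simpa using Complex.abs_im_le_norm (u x)))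
    fun g hg hgc ↦ ?_
  have hg₁ : HasCompactSupport (Complex.ofRealCLM ∘ g) := hgc.comp_left rfl
  have hg₂ : ContDiff ℝ ∞ (Complex.ofRealCLM ∘ g) := by fun_prop
  set G : 𝓢(E, ℂ) := hg₁.toSchwartzMap hg₂ with hG
  have hGx : ∀ x, G x = (g x : ℂ) := fun x ↦ by simp [hG]
  set k : 𝓢(E, ℂ) := 𝓕⁻ G
  have hk : ∀ ξ, k (-ξ) = (starRingEnd ℂ) (k ξ) := fun ξ ↦ by
    have h1 : ∀ ξ, k ξ = 𝓕 (G : E → ℂ) (-ξ) := fun ξ ↦ by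
      rw [← Real.fourierInv_eq_fourier_neg]; exact congrFun (fourierInv_coe G) ξ
    have h2 := fourierIntegral_neg_of_real (v := (G : E → ℂ)) (fun x ↦ by simp [hGx])
    rw [h1, h1, h2 (-ξ)]
  have h1 : ∫ x, G x * u x = ∫ ξ, k ξ * w ξ := by
    have h := integral_schwartz_mul_fourier u k
    rw [FourierTransform.fourier_fourierInv_eq] at h
    rw [← h]
    refine integral_congr_ae ?_
    filter_upwards [hw] with x hx using by rw [hx]
  have h2 : (starRingEnd ℂ) (∫ ξ, k ξ * w ξ) = ∫ ξ, k ξ * w ξ := by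
    rw [← integral_conj, ← integral_neg_eq_self]
    refine integral_congr_ae (.of_forall fun ξ ↦ ?_)
    simp [hk, hsymm]
  have hint : Integrable fun x ↦ G x * u x := by
    refine (hu.integrable_smul_left_of_hasCompactSupport (g := (G : E → ℂ)) G.continuous ?_)
    exact hg₁
  have h3 := integral_im hint
  simp only [RCLike.im_to_complex, hGx, Complex.im_ofReal_mul] at h3
  simp only [smul_eq_mul]
  rw [h3]
  simp only [hGx] at h1
  rw [h1]
  exact Complex.conj_eq_iff_im.1 h2

end FourierL2

/-! ### The Fourier transform of a truncated Riesz kernel -/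

section RieszKernel

open SchwartzMap Set

/-- A form of Peetre's inequality. -/
theorem one_add_norm_sq_rpow_le {E : Type*} [NormedAddCommGroup E] {a : ℝ}
    (ha : 0 < a) (ξ ζ : E) :
    (1 + ‖ξ‖ ^ 2) ^ (a / 2) ≤ 2 ^ a * ((1 + ‖ζ‖) ^ a + ‖ξ + ζ‖ ^ a) := by
  have h1 : (1 + ‖ξ‖ ^ 2) ^ (a / 2) ≤ (1 + ‖ξ‖) ^ a := by
    calc _ ≤ ((1 + ‖ξ‖) ^ 2) ^ (a / 2) := by
          refine Real.rpow_le_rpow (by positivity) ?_ (by positivity)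
          nlinarith [norm_nonneg ξ]
      _ = _ := by
          rw [← Real.rpow_natCast, ← Real.rpow_mul (by positivity)]
          congr 1
          push_cast
          ring
  have h2 : 1 + ‖ξ‖ ≤ (1 + ‖ζ‖) + ‖ξ + ζ‖ := by
    have := norm_sub_le (ξ + ζ) ζ
    rw [add_sub_cancel_right] at this
    linarith
  have h3 : (1 + ‖ξ‖) ≤ 2 * max (1 + ‖ζ‖) ‖ξ + ζ‖ := by
    have := le_max_left (1 + ‖ζ‖) ‖ξ + ζ‖
    have := le_max_right (1 + ‖ζ‖) ‖ξ + ζ‖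
    linarith
  have h4 : (max (1 + ‖ζ‖) ‖ξ + ζ‖) ^ a ≤ (1 + ‖ζ‖) ^ a + ‖ξ + ζ‖ ^ a := by
    rcases max_cases (1 + ‖ζ‖) ‖ξ + ζ‖ with h | h <;> rw [h.1]
    · exact le_add_of_nonneg_right (by positivity)
    · exact le_add_of_nonneg_left (by positivity)
  calc _ ≤ (1 + ‖ξ‖) ^ a := h1
    _ ≤ (2 * max (1 + ‖ζ‖) ‖ξ + ζ‖) ^ a := Real.rpow_le_rpow (by positivity) h3 ha.le
    _ = 2 ^ a * (max (1 + ‖ζ‖) ‖ξ + ζ‖) ^ a := Real.mul_rpow (by positivity) (by positivity)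
    _ ≤ _ := by gcongr

theorem exists_norm_mul_one_add_rpow_le {E : Type*} [NormedAddCommGroup E]
    [NormedSpace ℝ E] (k : 𝓢(E, ℂ)) (a r : ℝ) :
    ∃ C : ℝ, 0 ≤ C ∧ ∀ x, ‖k x‖ * (1 + ‖x‖) ^ a ≤ C * (1 + ‖x‖) ^ (-r) := by
  obtain ⟨N, hN⟩ := exists_nat_ge (a + r)
  set C := 2 ^ N * ((Finset.Iic (N, 0)).sup fun m ↦ SchwartzMap.seminorm ℝ m.1 m.2) k
  refine ⟨C, by positivity, fun x ↦ ?_⟩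
  have h := SchwartzMap.one_add_le_sup_seminorm_apply (𝕜 := ℝ) (m := (N, 0)) (le_refl N)
    (le_refl 0) k x
  rw [norm_iteratedFDeriv_zero] at h
  have h1 : (1 : ℝ) ≤ 1 + ‖x‖ := by linarith [norm_nonneg x]
  have h0 : (0 : ℝ) < 1 + ‖x‖ := by linarith
  calc ‖k x‖ * (1 + ‖x‖) ^ a = (1 + ‖x‖) ^ (a + r) * ‖k x‖ * (1 + ‖x‖) ^ (-r) := by
        rw [Real.rpow_add h0, Real.rpow_neg h0.le]
        field_simp
    _ ≤ (1 + ‖x‖) ^ N * ‖k x‖ * (1 + ‖x‖) ^ (-r) := by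
        rw [← Real.rpow_natCast]
        gcongr
    _ ≤ _ := by gcongr

variable {E : Type*} [NormedAddCommGroup E] [InnerProductSpace ℝ E] [FiniteDimensional ℝ E]
  [MeasurableSpace E] [BorelSpace E]

theorem locallyIntegrable_norm_rpow_neg {a : ℝ} (ha : 0 < a) (hn : a < Module.finrank ℝ E) :
    LocallyIntegrable fun x : E ↦ ‖x‖ ^ (-a) := by
  have hd : 1 ≤ Module.finrank ℝ E := by
    have : (0 : ℝ) < Module.finrank ℝ E := ha.trans hn
    exact_mod_cast this
  refine locallyIntegrable_of_norm_le_rpow (C := 1) hd hn (.of_forall fun x ↦ ?_)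
    (by fun_prop : Measurable fun x : E ↦ ‖x‖ ^ (-a)).aestronglyMeasurable
  rw [one_mul, Real.norm_of_nonneg (by positivity)]

/-- The Riesz potential of a bounded integrable function is bounded: the singularity is integrable
on the unit ball and the kernel is at most `1` outside. -/
theorem exists_lintegral_riesz_le {a : ℝ} (ha : 0 < a) (hn : a < Module.finrank ℝ E)
    {g : E → ℝ≥0∞} {M : ℝ≥0∞} (hM : M ≠ ⊤) (hg : ∀ x, g x ≤ M) (hg1 : ∫⁻ x, g x ≠ ⊤) :
    ∃ C : ℝ≥0∞, C ≠ ⊤ ∧ ∀ ξ : E, ∫⁻ x, g x * ENNReal.ofReal (‖ξ + x‖ ^ (-a)) ≤ C := by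
  set w : E → ℝ≥0∞ := (Metric.ball (0 : E) 1).indicator fun x ↦ ENNReal.ofReal (‖x‖ ^ (-a))
  have hwm : Measurable w :=
    (by fun_prop : Measurable fun x : E ↦ ENNReal.ofReal (‖x‖ ^ (-a))).indicator measurableSet_ball
  have hw : ∫⁻ x, w x ≠ ⊤ := by
    rw [lintegral_indicator measurableSet_ball]
    have hi : IntegrableOn (fun x : E ↦ ‖x‖ ^ (-a)) (Metric.ball 0 1) :=
      ((locallyIntegrable_norm_rpow_neg ha hn).integrableOn_isCompact
        (isCompact_closedBall 0 1)).mono_set Metric.ball_subset_closedBall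
    rw [← ofReal_integral_eq_lintegral_ofReal hi (.of_forall fun x ↦ by positivity)]
    exact ENNReal.ofReal_ne_top
  refine ⟨(M * ∫⁻ x, w x) + ∫⁻ x, g x, ENNReal.add_ne_top.2 ⟨ENNReal.mul_ne_top hM hw, hg1⟩,
    fun ξ ↦ ?_⟩
  have hpt : ∀ x, g x * ENNReal.ofReal (‖ξ + x‖ ^ (-a)) ≤ M * w (ξ + x) + g x := fun x ↦ by
    by_cases hx : ξ + x ∈ Metric.ball (0 : E) 1
    · have hwx : w (ξ + x) = _ := Set.indicator_of_mem hx _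
      rw [hwx]
      exact le_add_right (by gcongr; exact hg x)
    · have hwx : w (ξ + x) = _ := Set.indicator_of_notMem hx _
      rw [hwx, mul_zero, zero_add]
      refine mul_le_of_le_one_right' ?_
      rw [ENNReal.ofReal_le_one]
      refine Real.rpow_le_one_of_one_le_of_nonpos ?_ (by linarith)
      simpa using hx
  calc _ ≤ ∫⁻ x, (M * w (ξ + x) + g x) := lintegral_mono hpt
    _ = _ := by
      rw [lintegral_add_left (by fun_prop), lintegral_const_mul _ (by fun_prop),
        lintegral_add_left_eq_self]

/-- Multiplication by a Gaussian acts on the Fourier side as convolution with a Gaussian. -/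
theorem enorm_fourier_exp_neg_mul_sq_le (η : 𝓢(E, ℂ)) {t : ℝ} (ht : 0 < t) (ξ : E) :
    ‖𝓕 (fun x ↦ (Real.exp (-(t * ‖x‖ ^ 2)) : ℂ) * η x) ξ‖ₑ ≤
      ∫⁻ ζ, ‖(𝓕⁻ η) ζ‖ₑ * ENNReal.ofReal ((Real.pi / t) ^ ((Module.finrank ℝ E : ℝ) / 2) *
        Real.exp (-(Real.pi ^ 2 * ‖ξ + ζ‖ ^ 2 / t))) := by
  set G : E → ℂ := fun x ↦
    Complex.exp (-(t : ℂ) * ‖x‖ ^ 2 + 2 * Real.pi * Complex.I * (inner ℝ (-ξ) x : ℝ))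
  have htre : 0 < (t : ℂ).re := by simpa
  have hG : Integrable G := GaussianFourier.integrable_cexp_neg_mul_sq_norm_add htre _ _
  have h1 : 𝓕 (fun x ↦ (Real.exp (-(t * ‖x‖ ^ 2)) : ℂ) * η x) ξ =
      ∫ x, (𝓕⁻ η) x * 𝓕 G x := by
    rw [integral_schwartz_mul_fourierIntegral hG, FourierTransform.fourier_fourierInv_eq,
      Real.fourier_eq']
    refine integral_congr_ae (.of_forall fun x ↦ ?_)
    simp only [G, smul_eq_mul, Complex.ofReal_exp, ← mul_assoc, ← Complex.exp_add]
    rw [mul_comm]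
    congr 2
    rw [inner_neg_left, real_inner_comm]
    push_cast
    ring
  rw [h1]
  refine (enorm_integral_le_lintegral_enorm _).trans (lintegral_mono fun ζ ↦ ?_)
  rw [enorm_mul, fourier_gaussian_innerProductSpace' htre]
  gcongr
  rw [← ofReal_norm, norm_mul]
  refine ENNReal.ofReal_le_ofReal (le_of_eq ?_)
  congr 1
  · rw [← Complex.ofReal_div, show (Module.finrank ℝ E / 2 : ℂ) =
      (((Module.finrank ℝ E : ℝ) / 2 : ℝ) : ℂ) by push_cast; rfl,
      Complex.norm_cpow_eq_rpow_re_of_pos (by positivity), Complex.ofReal_re]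
  · rw [Complex.norm_exp, show -ξ - ζ = -(ξ + ζ) by abel, norm_neg]
    congr 1
    rw [show (-(Real.pi : ℂ) ^ 2 * (‖ξ + ζ‖ : ℂ) ^ 2 / t : ℂ) =
      ((-(Real.pi ^ 2 * ‖ξ + ζ‖ ^ 2 / t) : ℝ) : ℂ) by push_cast; ring, Complex.ofReal_re]

theorem integral_rpow_neg_mul_exp_neg_div {b c : ℝ} (hb : 0 < b) (hc : 0 < c) :
    ∫ t in Ioi (0 : ℝ), t ^ (-b - 1) * Real.exp (-(c / t)) = (1 / c) ^ b * Real.Gamma b := by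
  rw [← Real.integral_rpow_mul_exp_neg_mul_Ioi hb hc,
    ← integral_comp_rpow_Ioi (fun u ↦ u ^ (b - 1) * Real.exp (-(c * u)))
      (by norm_num : (-1 : ℝ) ≠ 0)]
  refine setIntegral_congr_fun measurableSet_Ioi fun t (ht : 0 < t) ↦ ?_
  simp only [smul_eq_mul, abs_neg, abs_one, one_mul]
  rw [← Real.rpow_mul ht.le, ← mul_assoc, ← Real.rpow_add ht, Real.rpow_neg_one, div_eq_mul_inv]
  congr 2
  ring

/-- The Fourier transforms of the Gaussians whose superposition is `|x|^{-α}` add up to a multiple of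
`|ξ|^{-(n - α)}`; here `ρ = |ξ|`. -/
theorem lintegral_rpow_mul_gaussian {α n ρ : ℝ} (hα : α < n) (hρ : 0 < ρ) :
    ∫⁻ t in Ioi (0 : ℝ), ENNReal.ofReal (t ^ (α / 2 - 1)) *
        ENNReal.ofReal ((Real.pi / t) ^ (n / 2) * Real.exp (-(Real.pi ^ 2 * ρ ^ 2 / t))) =
      ENNReal.ofReal (Real.pi ^ (α - n / 2) * Real.Gamma ((n - α) / 2)) *
        ENNReal.ofReal (ρ ^ (-(n - α))) := by
  have hb : 0 < (n - α) / 2 := by linarith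
  have hc : 0 < Real.pi ^ 2 * ρ ^ 2 := by positivity
  have hpi := Real.pi_pos
  have key := integral_rpow_neg_mul_exp_neg_div hb hc
  have hG : 0 < Real.Gamma ((n - α) / 2) := Real.Gamma_pos_of_pos hb
  have hint : IntegrableOn (fun t : ℝ ↦ t ^ (-((n - α) / 2) - 1) *
      Real.exp (-(Real.pi ^ 2 * ρ ^ 2 / t))) (Ioi 0) := by
    refine Integrable.of_integral_ne_zero ?_
    rw [key]
    positivity
  calc _ = ∫⁻ t in Ioi (0 : ℝ), ENNReal.ofReal (Real.pi ^ (n / 2)) * ENNReal.ofReal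
        (t ^ (-((n - α) / 2) - 1) * Real.exp (-(Real.pi ^ 2 * ρ ^ 2 / t))) := by
        refine setLIntegral_congr_fun measurableSet_Ioi fun t (ht : 0 < t) ↦ ?_
        rw [← ENNReal.ofReal_mul (by positivity), ← ENNReal.ofReal_mul (by positivity),
          Real.div_rpow hpi.le ht.le, show -((n - α) / 2) - 1 = (α / 2 - 1) - n / 2 by ring,
          Real.rpow_sub ht (α / 2 - 1)]
        congr 1
        ring
    _ = _ := by
        rw [lintegral_const_mul' _ _ ENNReal.ofReal_ne_top,
          ← ofReal_integral_eq_lintegral_ofReal hint, key, ← ENNReal.ofReal_mul (by positivity),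
          ← ENNReal.ofReal_mul (by positivity)]
        · congr 1
          have h1 : (1 / (Real.pi ^ 2 * ρ ^ 2)) ^ ((n - α) / 2) =
              Real.pi ^ (-(n - α)) * ρ ^ (-(n - α)) := by
            rw [← mul_pow, one_div, Real.inv_rpow (by positivity), ← Real.rpow_natCast,
              ← Real.rpow_mul (by positivity), ← Real.rpow_neg (by positivity),
              ← Real.mul_rpow hpi.le hρ.le]
            congr 1
            push_cast
            ring
          rw [h1, show α - n / 2 = n / 2 + -(n - α) by ring, Real.rpow_add hpi]
          ring
        · refine (ae_restrict_iff' measurableSet_Ioi).2 (.of_forall fun t (ht : 0 < t) ↦ ?_)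
          simp only [Pi.zero_apply]
          positivity

/-- The Fourier transform of `|x|^{-α} η(x)` is dominated by the Riesz potential of order `α` of
the Fourier transform of `η`. -/
theorem enorm_fourier_riesz_mul_le {α : ℝ} (hα : 0 < α) (hn : α < Module.finrank ℝ E)
    (η : 𝓢(E, ℂ)) (hη : Integrable fun x ↦ ((‖x‖ ^ (-α) : ℝ) : ℂ) * η x) :
    ∃ C : ℝ≥0∞, C ≠ ⊤ ∧ ∀ ξ, ‖𝓕 (fun x ↦ ((‖x‖ ^ (-α) : ℝ) : ℂ) * η x) ξ‖ₑ ≤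
      C * ∫⁻ ζ, ‖(𝓕⁻ η) ζ‖ₑ * ENNReal.ofReal (‖ξ + ζ‖ ^ (-(Module.finrank ℝ E - α))) := by
  set n : ℝ := ((Module.finrank ℝ E : ℕ) : ℝ) with hn_def
  have hnt : Nontrivial E := by
    apply Module.nontrivial_of_finrank_pos (R := ℝ)
    have : (0 : ℝ) < Module.finrank ℝ E := hα.trans hn
    exact_mod_cast this
  have hα2 : 0 < α / 2 := by linarith
  set Γ := Real.Gamma (α / 2)
  have hΓ : 0 < Γ := Real.Gamma_pos_of_pos hα2
  -- The Riesz kernel as a superposition of Gaussians.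
  have hrep : ∀ x : E, x ≠ 0 → ∫ t in Ioi (0 : ℝ), t ^ (α / 2 - 1) *
      Real.exp (-(t * ‖x‖ ^ 2)) = ‖x‖ ^ (-α) * Γ := fun x hx ↦ by
    have hx' : 0 < ‖x‖ := norm_pos_iff.2 hx
    have h := Real.integral_rpow_mul_exp_neg_mul_Ioi hα2 (by positivity : 0 < ‖x‖ ^ 2)
    simp_rw [mul_comm (‖x‖ ^ 2)] at h
    rw [h, one_div, Real.inv_rpow (by positivity), ← Real.rpow_natCast,
      ← Real.rpow_mul hx'.le, ← Real.rpow_neg hx'.le]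
    congr 2
    push_cast
    ring
  have hae : ∀ᵐ x : E, x ≠ 0 := by simp [ae_iff]
  set e : E → E → ℂ := fun ξ x ↦ Complex.exp ((-2 * Real.pi * inner ℝ x ξ : ℝ) * Complex.I)
  have he : ∀ ξ x, ‖e ξ x‖ = 1 := fun ξ x ↦ Complex.norm_exp_ofReal_mul_I _
  set F : E → E → ℝ → ℂ := fun ξ x t ↦
    ((t ^ (α / 2 - 1) * Real.exp (-(t * ‖x‖ ^ 2)) : ℝ) : ℂ) * (e ξ x * η x)
  have hFm : ∀ ξ, AEStronglyMeasurable (Function.uncurry (F ξ))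
      ((volume : Measure E).prod (volume.restrict (Ioi (0 : ℝ)))) := fun ξ ↦ by
    have : Measurable η := η.continuous.measurable
    refine Measurable.aestronglyMeasurable ?_
    simp only [F, e, Function.uncurry_def]
    fun_prop
  have hpos : ∀ x : E, 0 ≤ᵐ[volume.restrict (Ioi (0 : ℝ))]
      fun t ↦ t ^ (α / 2 - 1) * Real.exp (-(t * ‖x‖ ^ 2)) := fun x ↦ by
    refine (ae_restrict_iff' measurableSet_Ioi).2 (.of_forall fun t (ht : 0 < t) ↦ ?_)
    simp only [Pi.zero_apply]
    positivity
  have hFint : ∀ ξ, Integrable (Function.uncurry (F ξ))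
      ((volume : Measure E).prod (volume.restrict (Ioi (0 : ℝ)))) := fun ξ ↦ by
    rw [integrable_prod_iff (hFm ξ)]
    constructor
    · filter_upwards [hae] with x hx
      have : IntegrableOn (fun t ↦ t ^ (α / 2 - 1) * Real.exp (-(t * ‖x‖ ^ 2))) (Ioi 0) := by
        refine Integrable.of_integral_ne_zero ?_
        rw [hrep x hx]
        have : 0 < ‖x‖ := norm_pos_iff.2 hx
        positivity
      exact (Complex.ofRealCLM.integrable_comp this).mul_const (e ξ x * η x)
    · refine (hη.norm.const_mul Γ).congr ?_
      filter_upwards [hae] with x hx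
      have h1 : ∀ᵐ t ∂(volume.restrict (Ioi (0 : ℝ))), ‖Function.uncurry (F ξ) (x, t)‖ =
          t ^ (α / 2 - 1) * Real.exp (-(t * ‖x‖ ^ 2)) * ‖η x‖ := by
        filter_upwards [hpos x] with t ht
        simp only [F, Function.uncurry, norm_mul, he, one_mul]
        rw [Complex.norm_real, Real.norm_of_nonneg ht]
      rw [integral_congr_ae h1, integral_mul_const, hrep x hx, norm_mul, Complex.norm_real,
        Real.norm_of_nonneg (by positivity)]
      ring
  have hmain : ∀ ξ, (Γ : ℂ) * 𝓕 (fun x ↦ ((‖x‖ ^ (-α) : ℝ) : ℂ) * η x) ξ =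
      ∫ t in Ioi (0 : ℝ), ((t ^ (α / 2 - 1) : ℝ) : ℂ) *
        𝓕 (fun x ↦ (Real.exp (-(t * ‖x‖ ^ 2)) : ℂ) * η x) ξ := fun ξ ↦ by
    have h1 : (Γ : ℂ) * 𝓕 (fun x ↦ ((‖x‖ ^ (-α) : ℝ) : ℂ) * η x) ξ =
        ∫ x, ∫ t in Ioi (0 : ℝ), F ξ x t := by
      rw [Real.fourier_eq', ← integral_const_mul]
      refine integral_congr_ae ?_
      filter_upwards [hae] with x hx
      simp only [F]
      rw [integral_mul_const, integral_complex_ofReal, hrep x hx]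
      simp only [e, smul_eq_mul, Complex.ofReal_mul]
      ring
    rw [h1, integral_integral_swap (hFint ξ)]
    refine integral_congr_ae (.of_forall fun t ↦ ?_)
    simp only
    rw [Real.fourier_eq', ← integral_const_mul]
    refine integral_congr_ae (.of_forall fun x ↦ ?_)
    simp only [F, e, smul_eq_mul, Complex.ofReal_mul]
    ring
  set c : ℝ≥0∞ := ENNReal.ofReal (Real.pi ^ (α - n / 2) * Real.Gamma ((n - α) / 2))
  have hk : Measurable (𝓕⁻ η : 𝓢(E, ℂ)) := (𝓕⁻ η : 𝓢(E, ℂ)).continuous.measurable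
  refine ⟨ENNReal.ofReal Γ⁻¹ * c, ENNReal.mul_ne_top ENNReal.ofReal_ne_top ENNReal.ofReal_ne_top,
    fun ξ ↦ ?_⟩
  have hbound : ‖(Γ : ℂ) * 𝓕 (fun x ↦ ((‖x‖ ^ (-α) : ℝ) : ℂ) * η x) ξ‖ₑ ≤
      c * ∫⁻ ζ, ‖(𝓕⁻ η) ζ‖ₑ * ENNReal.ofReal (‖ξ + ζ‖ ^ (-(n - α))) := by
    rw [hmain]
    calc _ ≤ ∫⁻ t in Ioi (0 : ℝ), ∫⁻ ζ, ‖(𝓕⁻ η) ζ‖ₑ * (ENNReal.ofReal (t ^ (α / 2 - 1)) *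
          ENNReal.ofReal ((Real.pi / t) ^ (n / 2) *
            Real.exp (-(Real.pi ^ 2 * ‖ξ + ζ‖ ^ 2 / t)))) := by
          refine (enorm_integral_le_lintegral_enorm _).trans
            (setLIntegral_mono' measurableSet_Ioi fun t (ht : 0 < t) ↦ ?_)
          rw [enorm_mul, ← ofReal_norm, Complex.norm_real,
            Real.norm_of_nonneg (by positivity)]
          refine (mul_le_mul_right (enorm_fourier_exp_neg_mul_sq_le η ht ξ) _).trans (le_of_eq ?_)
          rw [← lintegral_const_mul' _ _ ENNReal.ofReal_ne_top]
          refine lintegral_congr fun ζ ↦ ?_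
          ring
      _ = ∫⁻ ζ, ∫⁻ t in Ioi (0 : ℝ), ‖(𝓕⁻ η) ζ‖ₑ * (ENNReal.ofReal (t ^ (α / 2 - 1)) *
          ENNReal.ofReal ((Real.pi / t) ^ (n / 2) *
            Real.exp (-(Real.pi ^ 2 * ‖ξ + ζ‖ ^ 2 / t)))) := by
          refine lintegral_lintegral_swap (Measurable.aemeasurable ?_)
          simp only [Function.uncurry_def]
          fun_prop
      _ = _ := by
          rw [← lintegral_const_mul' _ _ ENNReal.ofReal_ne_top]
          -- At `ζ = -ξ` the integral over `t` may diverge, whereas `0 ^ (-(n - α)) = 0` in Mathlib.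
          have hae' : ∀ᵐ ζ : E, ζ ≠ -ξ := by simp [ae_iff]
          refine lintegral_congr_ae ?_
          filter_upwards [hae'] with ζ hζ
          have hpos : 0 < ‖ξ + ζ‖ := norm_pos_iff.2 fun h ↦ hζ (eq_neg_of_add_eq_zero_right h)
          rw [lintegral_const_mul' _ _ enorm_ne_top, lintegral_rpow_mul_gaussian hn hpos]
          ring
  calc _ = ENNReal.ofReal Γ⁻¹ * ‖(Γ : ℂ) * 𝓕 (fun x ↦ ((‖x‖ ^ (-α) : ℝ) : ℂ) * η x) ξ‖ₑ := by
        rw [enorm_mul, ← ofReal_norm (Γ : ℂ), Complex.norm_real,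
          Real.norm_of_nonneg hΓ.le, ← mul_assoc, ← ENNReal.ofReal_mul (by positivity),
          inv_mul_cancel₀ hΓ.ne', ENNReal.ofReal_one, one_mul]
    _ ≤ _ := by
        rw [mul_assoc]
        gcongr

/-- The Fourier transform of `|x|^{-α} η(x)`, `η` a Schwartz function, is
`O((1 + |ξ|²)^{-(n - α) / 2})`. -/
theorem exists_norm_fourier_riesz_mul_le {α : ℝ} (hα : 0 < α) (hn : α < Module.finrank ℝ E)
    (η : 𝓢(E, ℂ)) (hη : Integrable fun x ↦ ((‖x‖ ^ (-α) : ℝ) : ℂ) * η x) :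
    ∃ C : ℝ, ∀ ξ, (1 + ‖ξ‖ ^ 2) ^ ((Module.finrank ℝ E - α) / 2) *
      ‖𝓕 (fun x ↦ ((‖x‖ ^ (-α) : ℝ) : ℂ) * η x) ξ‖ ≤ C := by
  set n : ℝ := ((Module.finrank ℝ E : ℕ) : ℝ)
  have ha : 0 < n - α := by linarith
  obtain ⟨A, hA, hAξ⟩ := enorm_fourier_riesz_mul_le hα hn η hη
  set k : 𝓢(E, ℂ) := 𝓕⁻ η
  obtain ⟨B, hB0, hB⟩ := exists_norm_mul_one_add_rpow_le k (n - α) (n + 1)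
  -- The factor `(1 + |ζ|)^{n-α}` of the weight is absorbed by the decay of `k`.
  set g : E → ℝ≥0∞ := fun ζ ↦ ‖k ζ‖ₑ * ENNReal.ofReal ((1 + ‖ζ‖) ^ (n - α))
  have hgle : ∀ ζ, g ζ ≤ ENNReal.ofReal (B * (1 + ‖ζ‖) ^ (-(n + 1))) := fun ζ ↦ by
    simp only [g]
    rw [← ofReal_norm, ← ENNReal.ofReal_mul (norm_nonneg _)]
    exact ENNReal.ofReal_le_ofReal (hB ζ)
  have hg1 : ∫⁻ ζ, g ζ ≠ ⊤ := by
    refine ne_top_of_le_ne_top ?_ (lintegral_mono hgle)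
    have hi : Integrable fun ζ : E ↦ B * (1 + ‖ζ‖) ^ (-(n + 1)) :=
      (integrable_one_add_norm (by linarith)).const_mul B
    rw [← ofReal_integral_eq_lintegral_ofReal hi (.of_forall fun x ↦ by positivity)]
    exact ENNReal.ofReal_ne_top
  have hgM : ∀ ζ, g ζ ≤ ENNReal.ofReal B := fun ζ ↦ by
    refine (hgle ζ).trans (ENNReal.ofReal_le_ofReal (mul_le_of_le_one_right hB0 ?_))
    exact Real.rpow_le_one_of_one_le_of_nonpos (by linarith [norm_nonneg ζ])
      (by linarith)
  obtain ⟨C, hC, hCξ⟩ := exists_lintegral_riesz_le ha (by linarith : n - α < n)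
    ENNReal.ofReal_ne_top hgM hg1
  have hkint : ∫⁻ ζ, ‖k ζ‖ₑ ≠ ⊤ := k.integrable.hasFiniteIntegral.ne
  set T : ℝ≥0∞ := A * (ENNReal.ofReal (2 ^ (n - α)) * (C + ∫⁻ ζ, ‖k ζ‖ₑ))
  have hT : T ≠ ⊤ := ENNReal.mul_ne_top hA (ENNReal.mul_ne_top ENNReal.ofReal_ne_top
    (ENNReal.add_ne_top.2 ⟨hC, hkint⟩))
  refine ⟨T.toReal, fun ξ ↦ ?_⟩
  rw [← ENNReal.ofReal_le_iff_le_toReal hT, ENNReal.ofReal_mul (by positivity),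
    ofReal_norm]
  have hkm : Measurable k := k.continuous.measurable
  calc _ ≤ ENNReal.ofReal ((1 + ‖ξ‖ ^ 2) ^ ((n - α) / 2)) *
        (A * ∫⁻ ζ, ‖k ζ‖ₑ * ENNReal.ofReal (‖ξ + ζ‖ ^ (-(n - α)))) := by
        gcongr
        exact hAξ ξ
    _ = A * ∫⁻ ζ, ENNReal.ofReal ((1 + ‖ξ‖ ^ 2) ^ ((n - α) / 2)) *
        (‖k ζ‖ₑ * ENNReal.ofReal (‖ξ + ζ‖ ^ (-(n - α)))) := by
        rw [lintegral_const_mul' _ _ ENNReal.ofReal_ne_top]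
        ring
    _ ≤ A * ∫⁻ ζ, ENNReal.ofReal (2 ^ (n - α)) *
        (g ζ * ENNReal.ofReal (‖ξ + ζ‖ ^ (-(n - α))) + ‖k ζ‖ₑ) := by
        refine mul_le_mul_right (lintegral_mono fun ζ ↦ ?_) _
        simp only
        set ρ := ‖ξ + ζ‖
        have h1 : ENNReal.ofReal ((1 + ‖ξ‖ ^ 2) ^ ((n - α) / 2)) ≤ ENNReal.ofReal (2 ^ (n - α)) *
            (ENNReal.ofReal ((1 + ‖ζ‖) ^ (n - α)) + ENNReal.ofReal (ρ ^ (n - α))) := by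
          rw [← ENNReal.ofReal_add (by positivity) (by positivity),
            ← ENNReal.ofReal_mul (by positivity)]
          exact ENNReal.ofReal_le_ofReal (one_add_norm_sq_rpow_le ha ξ ζ)
        have h2 : ENNReal.ofReal (ρ ^ (n - α)) * ENNReal.ofReal (ρ ^ (-(n - α))) ≤ 1 := by
          rw [← ENNReal.ofReal_mul (by positivity), ENNReal.ofReal_le_one,
            Real.rpow_neg (by positivity)]
          exact mul_inv_le_one
        calc _ ≤ ENNReal.ofReal (2 ^ (n - α)) * (ENNReal.ofReal ((1 + ‖ζ‖) ^ (n - α)) +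
                ENNReal.ofReal (ρ ^ (n - α))) *
                (‖k ζ‖ₑ * ENNReal.ofReal (ρ ^ (-(n - α)))) := by gcongr
          _ = ENNReal.ofReal (2 ^ (n - α)) * (g ζ * ENNReal.ofReal (ρ ^ (-(n - α))) +
                ‖k ζ‖ₑ * (ENNReal.ofReal (ρ ^ (n - α)) * ENNReal.ofReal (ρ ^ (-(n - α))))) := by
              simp only [g]
              ring
          _ ≤ _ := by
              gcongr
              exact mul_le_of_le_one_right' h2
    _ ≤ T := by
        rw [lintegral_const_mul' _ _ ENNReal.ofReal_ne_top, lintegral_add_right _ (by fun_prop)]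
        simp only [T]
        gcongr
        exact hCξ ξ

end RieszKernel

/-! ### The Hilbert space structure of `W^{s,2}(ℝ^d)` -/

section SobolevHilbert

variable {d : ℕ} {s : ℝ≥0}

/-- The real inner product of `W^{s,2}(ℝ^d)`, pulled back from `L²` by `SobolevSpace.toWeighted`. -/
noncomputable instance : InnerProductSpace ℝ (SobolevSpace d s) where
  inner f g := inner ℝ (SobolevSpace.toWeighted d s f) (SobolevSpace.toWeighted d s g)
  norm_sq_eq_re_inner f := norm_sq_eq_re_inner (𝕜 := ℝ) (SobolevSpace.toWeighted d s f)
  conj_inner_symm f g := inner_conj_symm (SobolevSpace.toWeighted d s f) _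
  add_left f g k := by rw [map_add, inner_add_left]
  smul_left f g c := by rw [map_smul, real_inner_smul_left]; rfl

namespace SobolevSpace

theorem inner_def (f g : SobolevSpace d s) :
    inner ℝ f g = inner ℝ (toWeighted d s f) (toWeighted d s g) := rfl

/-- The isometry `f ↦ (1 + |ξ|²)^{s/2} 𝓕f` from `W^{s,2}(ℝ^d)` to `L²(ℝ^d)`. -/
noncomputable def weightedIsometry (d : ℕ) (s : ℝ≥0) :
    SobolevSpace d s →ₗᵢ[ℝ] Lp ℂ 2 (volume : Measure (Space d)) where
  toLinearMap := toWeighted d s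
  norm_map' f := (norm_def f).symm

theorem coeFn_toWeighted (f : SobolevSpace d s) :
    toWeighted d s f =ᵐ[volume] weightedFourier d s (toL2Lin d s f) :=
  (memLp_weightedFourier f).coeFn_toLp

end SobolevSpace

theorem one_le_sobolevWeight (ξ : Space d) : 1 ≤ (1 + ‖ξ‖ ^ 2) ^ ((s : ℝ) / 2) :=
  Real.one_le_rpow (by nlinarith [sq_nonneg ‖ξ‖]) (by positivity)

theorem memLp_bdd_mul {E : Type*} [MeasurableSpace E] {μ : Measure E} {m : E → ℂ} {C : ℝ}
    (hm : AEStronglyMeasurable m μ) (hC : ∀ x, ‖m x‖ ≤ C) (f : Lp ℂ 2 μ) :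
    MemLp (fun x ↦ m x * f x) 2 μ :=
  MemLp.of_le_mul (Lp.memLp f) (hm.mul (Lp.aestronglyMeasurable f)) (.of_forall fun x ↦ by
    rw [norm_mul]; exact mul_le_mul_of_nonneg_right (hC x) (norm_nonneg _))

/-- Multiplication by a bounded measurable function, as a real-linear operator on `L²`. -/
noncomputable def mulL2 {E : Type*} [MeasurableSpace E] {μ : Measure E} (m : E → ℂ) (C : ℝ)
    (hm : AEStronglyMeasurable m μ) (hC : ∀ x, ‖m x‖ ≤ C) : Lp ℂ 2 μ →L[ℝ] Lp ℂ 2 μ :=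
  LinearMap.mkContinuous
    { toFun := fun f ↦ (memLp_bdd_mul hm hC f).toLp _
      map_add' := fun f g ↦ by
        rw [← MemLp.toLp_add]
        refine MemLp.toLp_congr _ _ ?_
        filter_upwards [Lp.coeFn_add f g] with x hx
        simp only [hx, Pi.add_apply, mul_add]
      map_smul' := fun c f ↦ by
        rw [RingHom.id_apply, ← MemLp.toLp_const_smul]
        refine MemLp.toLp_congr _ _ ?_
        filter_upwards [Lp.coeFn_smul c f] with x hx
        simp only [hx, Pi.smul_apply, Complex.real_smul]
        ring } C fun f ↦ by
    refine Lp.norm_le_mul_norm_of_ae_le_mul ?_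
    filter_upwards [(memLp_bdd_mul hm hC f).coeFn_toLp] with x hx
    simp only [LinearMap.coe_mk, AddHom.coe_mk]
    rw [hx, norm_mul]
    exact mul_le_mul_of_nonneg_right (hC x) (norm_nonneg _)

theorem coeFn_mulL2 {E : Type*} [MeasurableSpace E] {μ : Measure E} {m : E → ℂ} {C : ℝ}
    (hm : AEStronglyMeasurable m μ) (hC : ∀ x, ‖m x‖ ≤ C) (f : Lp ℂ 2 μ) :
    mulL2 m C hm hC f =ᵐ[μ] fun x ↦ m x * f x :=
  (memLp_bdd_mul hm hC f).coeFn_toLp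

theorem continuous_realFourier : Continuous (realFourier d) :=
  AddMonoidHomClass.continuous_of_bound (realFourier d) 1
    fun f ↦ by rw [norm_realFourier, one_mul]

theorem inner_realFourier (f g : Lp ℝ 2 (volume : Measure (Space d))) :
    inner ℝ (realFourier d f) (realFourier d g) = inner ℝ f g := by
  let F : Lp ℝ 2 (volume : Measure (Space d)) →ₗᵢ[ℝ] Lp ℂ 2 (volume : Measure (Space d)) :=
    ⟨realFourier d, norm_realFourier⟩
  exact F.inner_map_map f g

instance : CompleteSpace (SobolevSpace d s) := by
  refine Metric.complete_of_cauchySeq_tendsto fun u hu ↦ ?_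
  have h1 : CauchySeq fun k ↦ SobolevSpace.toWeighted d s (u k) :=
    hu.map (SobolevSpace.weightedIsometry d s).isometry.uniformContinuous
  have h2 : CauchySeq fun k ↦ SobolevSpace.toL2Lin d s (u k) :=
    hu.map (SobolevSpace.toL2 d s).uniformContinuous
  obtain ⟨w, hw⟩ := cauchySeq_tendsto_of_complete h1
  obtain ⟨f, hf⟩ := cauchySeq_tendsto_of_complete h2
  -- Dividing by the weight is bounded on `L²`, so both limits are related as their terms are.
  set r : Space d → ℂ := fun ξ ↦ (((1 + ‖ξ‖ ^ 2) ^ ((s : ℝ) / 2))⁻¹ : ℝ)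
  have hr : AEStronglyMeasurable r volume :=
    (by fun_prop : Measurable r).aestronglyMeasurable
  have hr1 : ∀ ξ, ‖r ξ‖ ≤ 1 := fun ξ ↦ by
    simp only [r]
    rw [Complex.norm_real, Real.norm_of_nonneg (by positivity)]
    exact inv_le_one_of_one_le₀ (one_le_sobolevWeight ξ)
  have h3 : ∀ k, mulL2 r 1 hr hr1 (SobolevSpace.toWeighted d s (u k)) =
      realFourier d (SobolevSpace.toL2Lin d s (u k)) := fun k ↦ by
    refine Lp.ext ?_
    filter_upwards [coeFn_mulL2 hr hr1 (SobolevSpace.toWeighted d s (u k)),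
      SobolevSpace.coeFn_toWeighted (u k)] with ξ h1 h2
    have h0 := one_le_sobolevWeight (s := s) ξ
    rw [h1, h2, weightedFourier, Complex.real_smul, ← mul_assoc, ← Complex.ofReal_mul,
      inv_mul_cancel₀ (by linarith), Complex.ofReal_one, one_mul]
  have h4 : mulL2 r 1 hr hr1 w = realFourier d f := by
    refine tendsto_nhds_unique (((mulL2 r 1 hr hr1).continuous.tendsto w).comp hw) ?_
    refine ((continuous_realFourier.tendsto f).comp hf).congr fun k ↦ ?_
    exact (h3 k).symm
  have h5 : weightedFourier d s f =ᵐ[volume] w := by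
    filter_upwards [coeFn_mulL2 hr hr1 w] with ξ h1
    have h0 := one_le_sobolevWeight (s := s) ξ
    rw [weightedFourier, ← h4, h1, Complex.real_smul, ← mul_assoc, ← Complex.ofReal_mul,
      mul_inv_cancel₀ (by linarith), Complex.ofReal_one, one_mul]
  set F : SobolevSpace d s := ⟨f, (memLp_congr_ae h5).2 (Lp.memLp w)⟩
  have h6 : SobolevSpace.toWeighted d s F = w := by
    refine Lp.ext ((SobolevSpace.coeFn_toWeighted F).trans h5)
  refine ⟨F, ?_⟩
  rw [(SobolevSpace.weightedIsometry d s).isometry.isUniformInducing.isInducing.tendsto_nhds_iff]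
  change Filter.Tendsto _ _ (nhds (SobolevSpace.toWeighted d s F))
  rw [h6]
  exact hw

end SobolevHilbert

/-! ### The dual of `W^{s,2}(D)` -/

section Dual

variable {d : ℕ} {D : Opens (Space d)} {s : ℝ≥0}

theorem SobolevOn.toL2_mk (f : SobolevSpace d s) :
    SobolevOn.toL2 D s ((vanishingOn D s).mkQL f) = sobolevRestrict D s f := rfl

theorem SobolevOn.toL2_injective : Function.Injective (SobolevOn.toL2 D s) := by
  refine (injective_iff_map_eq_zero _).2 fun q hq ↦ ?_
  obtain ⟨f, rfl⟩ := (vanishingOn D s).mkQ_surjective q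
  exact (Submodule.Quotient.mk_eq_zero _).2 (LinearMap.mem_ker.2 hq)

theorem coeFn_sobolevRestrict (f : SobolevSpace d s) :
    sobolevRestrict D s f =ᵐ[volume.restrict (D : Set (Space d))] SobolevSpace.toL2Lin d s f :=
  LpToLpRestrictCLM_coeFn ℝ (D : Set (Space d)) (SobolevSpace.toL2Lin d s f)

/-- The element of `W^{s,2}(ℝ^d)` which represents, through the inner product, a functional on
`W^{s,2}(D)`. -/
noncomputable def rieszRepr (D : Opens (Space d)) (s : ℝ≥0) :
    SobolevDual D s →ₗᵢ[ℝ] SobolevSpace d s where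
  toFun ℓ := (InnerProductSpace.toDual ℝ (SobolevSpace d s)).symm (ℓ.comp (vanishingOn D s).mkQL)
  map_add' ℓ₁ ℓ₂ := by rw [ContinuousLinearMap.add_comp, map_add]
  map_smul' c ℓ := by rw [ContinuousLinearMap.smul_comp, map_smulₛₗ]; rfl
  norm_map' ℓ := by
    simp only [LinearMap.coe_mk, AddHom.coe_mk, LinearIsometryEquiv.norm_map]
    refine le_antisymm (ContinuousLinearMap.opNorm_le_bound _ (norm_nonneg ℓ) fun f ↦ ?_)
      (ContinuousLinearMap.opNorm_le_bound _ (norm_nonneg _) fun q ↦ ?_)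
    · exact (ℓ.le_opNorm _).trans
        (mul_le_mul_of_nonneg_left (Submodule.Quotient.norm_mk_le _ f) (norm_nonneg _))
    · refine le_of_forall_pos_le_add fun ε hε ↦ ?_
      set c := ‖ℓ.comp (vanishingOn D s).mkQL‖
      have hc : 0 ≤ c := norm_nonneg _
      obtain ⟨f, rfl, hf⟩ := Submodule.Quotient.norm_mk_lt q (div_pos hε
        (by positivity : 0 < c + 1))
      have h1 : ‖ℓ (Submodule.Quotient.mk f)‖ ≤ c * ‖f‖ :=
        (ℓ.comp (vanishingOn D s).mkQL).le_opNorm f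
      have h2 : c * (ε / (c + 1)) ≤ ε := by
        rw [mul_div_assoc', div_le_iff₀ (by positivity)]
        nlinarith
      nlinarith [mul_le_mul_of_nonneg_left hf.le hc]

theorem inner_rieszRepr (ℓ : SobolevDual D s) (f : SobolevSpace d s) :
    inner ℝ (rieszRepr D s ℓ) f = ℓ ((vanishingOn D s).mkQL f) :=
  InnerProductSpace.toDual_symm_apply (𝕜 := ℝ)

theorem L2ToDual_mk (φ : Lp ℝ 2 (volume.restrict (D : Set (Space d)))) (f : SobolevSpace d s) :
    L2ToDual D s φ ((vanishingOn D s).mkQL f) =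
      ∫ z in (D : Set (Space d)), φ z * SobolevSpace.toL2Lin d s f z := by
  rw [L2ToDual_apply, SobolevOn.toL2_mk]
  refine integral_congr_ae ?_
  filter_upwards [coeFn_sobolevRestrict f] with z h1
  rw [h1]

theorem coeFn_testToL2 (ψ : 𝓓(D, ℝ)) :
    testToL2 D ψ =ᵐ[volume.restrict (D : Set (Space d))] ψ :=
  MemLp.coeFn_toLp _

/-- The inclusion of the test functions on `D` in `W_0^{-s,2}(D)`, as a linear map. -/
noncomputable def testToDual (D : Opens (Space d)) (s : ℝ≥0) : 𝓓(D, ℝ) →ₗ[ℝ] SobolevDual D s where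
  toFun ψ := L2ToDual D s (testToL2 D ψ)
  map_add' ψ₁ ψ₂ := by
    have h : testToL2 D (ψ₁ + ψ₂) = testToL2 D ψ₁ + testToL2 D ψ₂ := by
      rw [testToL2, testToL2, testToL2, ← MemLp.toLp_add]
      exact MemLp.toLp_congr _ _ (.of_forall fun x ↦ rfl)
    simp only [L2ToDual, h, map_add, ContinuousLinearMap.add_comp]
  map_smul' c ψ := by
    have h : testToL2 D (c • ψ) = c • testToL2 D ψ := by
      rw [testToL2, testToL2, ← MemLp.toLp_const_smul]
      exact MemLp.toLp_congr _ _ (.of_forall fun x ↦ rfl)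
    ext f
    simp only [L2ToDual, h, map_smul, ContinuousLinearMap.comp_apply, RingHom.id_apply,
      smul_apply]

theorem testToDual_apply (ψ : 𝓓(D, ℝ)) : testToDual D s ψ = L2ToDual D s (testToL2 D ψ) := rfl

theorem mem_vanishingOn_of_testToDual_eq_zero {f : SobolevSpace d s}
    (h : ∀ ψ : 𝓓(D, ℝ), testToDual D s ψ ((vanishingOn D s).mkQL f) = 0) : f ∈ vanishingOn D s := by
  refine LinearMap.mem_ker.2 (Lp.ext ?_)
  have h1 : ∀ᵐ x, x ∈ (D : Set (Space d)) → SobolevSpace.toL2Lin d s f x = 0 := by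
    refine D.isOpen.ae_eq_zero_of_integral_contDiff_smul_eq_zero
      (((Lp.memLp (SobolevSpace.toL2Lin d s f)).locallyIntegrable
        (by norm_num)).locallyIntegrableOn _)
      fun g hg hgc hgD ↦ ?_
    let ψ : 𝓓(D, ℝ) := ⟨g, hg, hgc, hgD⟩
    have h2 := h ψ
    rw [testToDual_apply, L2ToDual_mk] at h2
    rw [← setIntegral_eq_integral_of_forall_compl_eq_zero (s := (D : Set (Space d))), ← h2]
    · refine integral_congr_ae ?_
      filter_upwards [coeFn_testToL2 ψ] with x hx
      rw [hx]
      rfl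
    · intro x hx
      rw [image_eq_zero_of_notMem_tsupport fun hx' ↦ hx (hgD hx'), zero_smul]
  have h2 := (ae_restrict_iff' D.isOpen.measurableSet).2 h1
  change sobolevRestrict D s f =ᵐ[_] _
  filter_upwards [h2, coeFn_sobolevRestrict (D := D) f,
    Lp.coeFn_zero ℝ 2 (volume.restrict (D : Set (Space d)))] with x h3 h4 h5
  rw [h4, h3, h5]
  rfl

/-- The test functions are dense in `W_0^{-s,2}(D)`, as the predual `W^{s,2}(D)` is a Hilbert
space: a function orthogonal to all of them vanishes on `D`. -/
theorem denseRange_testToDual : DenseRange (testToDual D s) := by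
  intro ℓ
  set S : Submodule ℝ (SobolevSpace d s) :=
    ((rieszRepr D s).toLinearMap.comp (testToDual D s)).range
  have hS : Sᗮ ≤ vanishingOn D s := fun f hf ↦ by
    refine mem_vanishingOn_of_testToDual_eq_zero fun ψ ↦ ?_
    rw [← inner_rieszRepr]
    exact (Submodule.mem_orthogonal _ _).1 hf _ ⟨ψ, rfl⟩
  have hℓ : rieszRepr D s ℓ ∈ Sᗮᗮ := by
    refine (Submodule.mem_orthogonal' _ _).2 fun f hf ↦ ?_
    rw [inner_rieszRepr]
    have : (vanishingOn D s).mkQL f = 0 := (Submodule.Quotient.mk_eq_zero _).2 (hS hf)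
    rw [this, map_zero]
  rw [Submodule.orthogonal_orthogonal_eq_closure] at hℓ
  rw [(rieszRepr D s).isometry.isUniformInducing.isInducing.closure_eq_preimage_closure_image]
  change rieszRepr D s ℓ ∈ closure _
  rw [← Set.range_comp]
  exact hℓ

end Dual

/-! ### The potential operator on `W_0^{-s,2}(D)` -/

section PotentialOperator

open scoped Convolution

variable {d : ℕ} {D : Opens (Space d)} {s : ℝ≥0}

/-- A square integrable spectrum `w`, with the decay of a function in `W^{s,2}` and whose inverse
Fourier transform is real-valued, is the spectrum of an element of `W^{s,2}(ℝ^d)`. -/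
theorem exists_sobolevSpace_of_spectrum {w : Space d → ℂ} (hw : MemLp w 2)
    (hws : MemLp (fun ξ ↦ ((1 + ‖ξ‖ ^ 2) ^ ((s : ℝ) / 2) : ℝ) • w ξ) 2)
    (him : ∀ᵐ x, ((𝓕⁻ (hw.toLp w) : Lp ℂ 2 (volume : Measure (Space d))) x).im = 0) :
    ∃ f : SobolevSpace d s,
      SobolevSpace.toWeighted d s f =ᵐ[volume]
        (fun ξ ↦ ((1 + ‖ξ‖ ^ 2) ^ ((s : ℝ) / 2) : ℝ) • w ξ) ∧
      (fun x ↦ (SobolevSpace.toL2Lin d s f x : ℂ)) =ᵐ[volume]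
        (𝓕⁻ (hw.toLp w) : Lp ℂ 2 (volume : Measure (Space d))) := by
  set u : Lp ℂ 2 (volume : Measure (Space d)) := 𝓕⁻ (hw.toLp w)
  set U : Lp ℝ 2 (volume : Measure (Space d)) := Complex.reCLM.compLp u
  have hU : (fun x ↦ (U x : ℂ)) =ᵐ[volume] u := by
    filter_upwards [him, Complex.reCLM.coeFn_compLp u] with x h1 h2
    rw [h2]
    exact Complex.ext rfl h1.symm
  have hUu : Complex.ofRealCLM.compLpL 2 (volume : Measure (Space d)) U = u := by
    refine Lp.ext ?_
    filter_upwards [hU, Complex.ofRealCLM.coeFn_compLpL (p := 2) U] with x h1 h2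
    rw [h2, ← h1]
    rfl
  have hF : realFourier d U = hw.toLp w := by
    change 𝓕 (Complex.ofRealCLM.compLpL 2 (volume : Measure (Space d)) U) = _
    rw [hUu]
    exact FourierTransform.fourier_fourierInv_eq _
  have hW : weightedFourier d s U =ᵐ[volume]
      fun ξ ↦ ((1 + ‖ξ‖ ^ 2) ^ ((s : ℝ) / 2) : ℝ) • w ξ := by
    filter_upwards [hw.coeFn_toLp] with ξ h1
    rw [weightedFourier, hF, h1]
  exact ⟨⟨U, (memLp_congr_ae hW).2 hws⟩, (SobolevSpace.coeFn_toWeighted _).trans hW, hU⟩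

/-- If `𝓕f = (1 + |ξ|²)^{-s} 𝓕φ`, then `f` represents, in the Hilbert space `W^{s,2}(ℝ^d)`, the `L²`
inner product with `φ`. -/
theorem inner_eq_inner_toL2Lin {f : SobolevSpace d s} {v : Space d → ℂ}
    (hv : SobolevSpace.toWeighted d s f =ᵐ[volume]
      fun ξ ↦ ((1 + ‖ξ‖ ^ 2) ^ ((s : ℝ) / 2) : ℝ)⁻¹ • v ξ)
    {φ : Lp ℝ 2 (volume : Measure (Space d))} (hφ : realFourier d φ =ᵐ[volume] v)
    (g : SobolevSpace d s) : inner ℝ f g = inner ℝ φ (SobolevSpace.toL2Lin d s g) := by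
  rw [← inner_realFourier, SobolevSpace.inner_def, L2.inner_def, L2.inner_def]
  refine integral_congr_ae ?_
  filter_upwards [hv, hφ, SobolevSpace.coeFn_toWeighted g] with ξ h1 h2 h3
  have h0 := one_le_sobolevWeight (s := s) ξ
  rw [h1, h2, h3, weightedFourier, real_inner_smul_left, real_inner_smul_right, ← mul_assoc,
    inv_mul_cancel₀ (by linarith), one_mul]

/-- Near the difference set `D - D`, the kernel `|x|^{-α} e^{α h(x)}` coincides with an integrable
kernel whose Fourier transform is `O((1 + |ξ|²)^{-(d - α) / 2})`. -/
theorem exists_kernel (hD : Bornology.IsBounded (D : Set (Space d))) {h : Space d → ℝ}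
    (hh : ContDiff ℝ ∞ h) {α : ℝ} (hα : 0 < α) (hαd : α < d) :
    ∃ (k : Space d → ℝ) (C : ℝ), Integrable (fun x ↦ (k x : ℂ)) ∧
      (∀ z ∈ D, ∀ y ∈ D, k (z - y) = ‖z - y‖ ^ (-α) * Real.exp (α * h (z - y))) ∧
      ∀ ξ, (1 + ‖ξ‖ ^ 2) ^ ((d - α) / 2) * ‖𝓕 (fun x ↦ (k x : ℂ)) ξ‖ ≤ C := by
  obtain ⟨R, hR⟩ := (hD.sub hD).subset_closedBall 0
  let χ : ContDiffBump (0 : Space d) :=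
    ⟨|R| + 1, |R| + 2, by positivity, by linarith⟩
  have hχc : HasCompactSupport fun x ↦ ((χ x * Real.exp (α * h x) : ℝ) : ℂ) :=
    (χ.hasCompactSupport.mul_right (f' := fun x ↦ Real.exp (α * h x))).comp_left
      Complex.ofReal_zero
  have hχs : ContDiff ℝ ∞ fun x ↦ ((χ x * Real.exp (α * h x) : ℝ) : ℂ) :=
    Complex.ofRealCLM.contDiff.comp (χ.contDiff.mul ((contDiff_const.mul hh).exp))
  set η : SchwartzMap (Space d) ℂ := hχc.toSchwartzMap hχs
  have hη : ∀ x, η x = ((χ x * Real.exp (α * h x) : ℝ) : ℂ) := fun x ↦ by simp [η]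
  have hn : α < (Module.finrank ℝ (Space d) : ℝ) := by simpa using hαd
  have hint : Integrable fun x : Space d ↦ ((‖x‖ ^ (-α) : ℝ) : ℂ) * η x := by
    have h1 := (locallyIntegrable_norm_rpow_neg hα hn).integrable_smul_right_of_hasCompactSupport
      η.continuous hχc
    simpa [Complex.real_smul] using h1
  obtain ⟨C, hC⟩ := exists_norm_fourier_riesz_mul_le hα hn η hint
  have hk : (fun x ↦ ((‖x‖ ^ (-α) * (χ x * Real.exp (α * h x)) : ℝ) : ℂ)) =
      fun x : Space d ↦ ((‖x‖ ^ (-α) : ℝ) : ℂ) * η x := by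
    ext x
    rw [hη, ← Complex.ofReal_mul]
  refine ⟨fun x ↦ ‖x‖ ^ (-α) * (χ x * Real.exp (α * h x)), C, ?_, fun z hz y hy ↦ ?_, fun ξ ↦ ?_⟩
  · rw [hk]
    exact hint
  · have h1 : z - y ∈ Metric.closedBall (0 : Space d) (|R| + 1) :=
      Metric.closedBall_subset_closedBall (by linarith [le_abs_self R])
        (hR (Set.sub_mem_sub hz hy))
    simp only [χ.one_of_mem_closedBall h1, one_mul]
  · rw [hk]
    have := hC ξ
    rwa [finrank_euclideanSpace_fin] at this

theorem coe_sobolevOrder {α : ℝ} (hαd : α < d) : (sobolevOrder d α : ℝ) = (d - α) / 2 :=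
  Real.coe_toNNReal _ (by linarith)

/-- `G_α` extends to a bounded operator from `W_0^{-s,2}(D)` to `W^{s,2}(D)`, `s = (d - α) / 2`: on
the Fourier side it is the multiplication by a function of order `-2s`. -/
theorem exists_potentialOperator (hD : Bornology.IsBounded (D : Set (Space d)))
    {h : Space d → ℝ} (hh : ContDiff ℝ ∞ h) {α : ℝ} (hα : 0 < α) (hαd : α < d) :
    ∃ T : SobolevDual D (sobolevOrder d α) →L[ℝ] SobolevOn D (sobolevOrder d α),
      ∀ φ : Lp ℝ 2 (volume.restrict (D : Set (Space d))),
        (SobolevOn.toL2 D (sobolevOrder d α) (T (L2ToDual D (sobolevOrder d α) φ)) : Space d → ℝ)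
          =ᵐ[volume.restrict (D : Set (Space d))] potential D h α φ := by
  set s := sobolevOrder d α
  have hs : (s : ℝ) = (d - α) / 2 := coe_sobolevOrder hαd
  obtain ⟨k, C, hk, hkD, hC⟩ := exists_kernel hD hh hα hαd
  set κ : Space d → ℂ := 𝓕 fun x ↦ (k x : ℂ)
  have hκ : Continuous κ := continuous_fourierIntegral hk
  set q : Space d → ℝ := fun ξ ↦ (1 + ‖ξ‖ ^ 2) ^ ((s : ℝ) / 2)
  have hq1 : ∀ ξ, 1 ≤ q ξ := one_le_sobolevWeight
  have hq0 : ∀ ξ, q ξ ≠ 0 := fun ξ ↦ by linarith [hq1 ξ]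
  have hqm : Measurable q := by fun_prop
  have hq2 : ∀ ξ, q ξ * q ξ = (1 + ‖ξ‖ ^ 2) ^ ((d - α) / 2) := fun ξ ↦ by
    rw [← hs, ← Real.rpow_add (by positivity), add_halves]
  -- The bounded multiplier which takes the spectrum of the Riesz representative of `φ` to the
  -- spectrum of the convolution with `φ`.
  set m : Space d → ℂ := fun ξ ↦ ((q ξ * q ξ : ℝ) : ℂ) * κ ξ
  have hm : AEStronglyMeasurable m volume := by
    have := hκ.measurable
    exact (by fun_prop : Measurable m).aestronglyMeasurable
  have hmC : ∀ ξ, ‖m ξ‖ ≤ C := fun ξ ↦ by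
    rw [norm_mul, Complex.norm_real, Real.norm_of_nonneg (mul_self_nonneg _), hq2]
    exact hC ξ
  -- Composing with the adjoint of the isometry `W` projects the multiplied spectrum onto the
  -- spectra of real-valued functions, so that `A` maps the real space `W^{s,2}(ℝ^d)` to itself.
  set W := SobolevSpace.weightedIsometry d s
  let A : SobolevSpace d s →L[ℝ] SobolevSpace d s :=
    (ContinuousLinearMap.adjoint W.toContinuousLinearMap).comp
      ((mulL2 m C hm hmC).comp W.toContinuousLinearMap)
  refine ⟨((vanishingOn D s).mkQL.comp A).comp (rieszRepr D s).toContinuousLinearMap,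
    fun φ ↦ ?_⟩
  have hDm : MeasurableSet (D : Set (Space d)) := D.isOpen.measurableSet
  have : IsFiniteMeasure (volume.restrict (D : Set (Space d))) :=
    ⟨by rw [Measure.restrict_apply_univ]; exact hD.measure_lt_top⟩
  -- The extension of `φ` by zero.
  set Φ : Space d → ℝ := (D : Set (Space d)).indicator φ
  have hΦ2 : MemLp Φ 2 := (memLp_indicator_iff_restrict hDm).2 (Lp.memLp φ)
  have hΦ1 : Integrable Φ :=
    (integrable_indicator_iff hDm).2 ((Lp.memLp φ).integrable (by norm_num))
  have hΦC1 : Integrable fun x ↦ (Φ x : ℂ) := hΦ1.ofReal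
  have hΦC2 : MemLp (fun x ↦ (Φ x : ℂ)) 2 := hΦ2.ofReal
  set v : Space d → ℂ := 𝓕 fun x ↦ (Φ x : ℂ)
  have hv : realFourier d (hΦ2.toLp Φ) =ᵐ[volume] v := by
    have h1 : Complex.ofRealCLM.compLpL 2 (volume : Measure (Space d)) (hΦ2.toLp Φ) =
        hΦC2.toLp _ := by
      refine Lp.ext ?_
      filter_upwards [Complex.ofRealCLM.coeFn_compLpL (p := 2) (hΦ2.toLp Φ), hΦ2.coeFn_toLp,
        hΦC2.coeFn_toLp] with x h1 h2 h3
      rw [h1, h2, h3]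
      rfl
    change (𝓕 (Complex.ofRealCLM.compLpL 2 (volume : Measure (Space d)) (hΦ2.toLp Φ)) :
      Lp ℂ 2 (volume : Measure (Space d))) =ᵐ[volume] v
    rw [h1]
    exact coeFn_fourier_toLp hΦC1 hΦC2
  have hv2 : MemLp v 2 := (memLp_congr_ae hv).1 (Lp.memLp _)
  have hvsymm : ∀ ξ, v (-ξ) = (starRingEnd ℂ) (v ξ) :=
    fourierIntegral_neg_of_real fun x ↦ Complex.conj_ofReal _
  have hvc : Continuous v := continuous_fourierIntegral hΦC1
  have hle : ∀ ξ, (q ξ)⁻¹ ≤ 1 := fun ξ ↦ inv_le_one_of_one_le₀ (hq1 ξ)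
  have hnn : ∀ ξ, 0 ≤ (q ξ)⁻¹ := fun ξ ↦ inv_nonneg.2 (by linarith [hq1 ξ])
  -- The Riesz representative of `φ`, with spectrum `(1 + |ξ|²)^{-s} 𝓕φ(ξ)`.
  set w₁ : Space d → ℂ := fun ξ ↦ ((q ξ)⁻¹ * (q ξ)⁻¹) • v ξ
  have hw₁s : MemLp (fun ξ ↦ (q ξ)⁻¹ • v ξ) 2 := by
    refine hv2.of_le (by fun_prop) (.of_forall fun ξ ↦ ?_)
    rw [norm_smul, Real.norm_of_nonneg (hnn ξ)]
    exact mul_le_of_le_one_left (norm_nonneg _) (hle ξ)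
  have hqw₁ : (fun ξ ↦ q ξ • w₁ ξ) = fun ξ ↦ (q ξ)⁻¹ • v ξ := by
    ext ξ
    simp only [w₁]
    rw [smul_smul, ← mul_assoc, mul_inv_cancel₀ (hq0 ξ), one_mul]
  have hw₁ : MemLp w₁ 2 := by
    refine hv2.of_le (by fun_prop) (.of_forall fun ξ ↦ ?_)
    rw [norm_smul, Real.norm_of_nonneg (mul_nonneg (hnn ξ) (hnn ξ))]
    exact mul_le_of_le_one_left (norm_nonneg _) (mul_le_one₀ (hle ξ) (hnn ξ) (hle ξ))
  obtain ⟨F₁, hF₁, -⟩ := exists_sobolevSpace_of_spectrum (s := s) hw₁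
    (by change MemLp (fun ξ ↦ q ξ • w₁ ξ) 2; rwa [hqw₁])
    (im_ae_eq_zero_of_fourier_neg (w := w₁)
      (by rw [FourierTransform.fourier_fourierInv_eq]; exact hw₁.coeFn_toLp)
      fun ξ ↦ by simp [w₁, q, hvsymm])
  have hF₁' : SobolevSpace.toWeighted d s F₁ =ᵐ[volume] fun ξ ↦ (q ξ)⁻¹ • v ξ := by
    rw [← hqw₁]
    exact hF₁
  have hrep : rieszRepr D s (L2ToDual D s φ) = F₁ := by
    refine ext_inner_right ℝ fun g ↦ ?_
    rw [inner_rieszRepr, L2ToDual_mk, inner_eq_inner_toL2Lin hF₁' hv, L2.inner_def,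
      ← integral_indicator hDm]
    refine integral_congr_ae ?_
    filter_upwards [hΦ2.coeFn_toLp] with x hx
    rw [hx]
    by_cases hxD : x ∈ (D : Set (Space d)) <;> simp [Φ, hxD, mul_comm]
  -- The convolution of the kernel with `φ`.
  set u : Space d → ℂ := (fun x ↦ (k x : ℂ)) ⋆[ContinuousLinearMap.mul ℂ ℂ] fun x ↦ (Φ x : ℂ)
  have hu : Integrable u := hk.integrable_convolution _ hΦC1
  have hureal : ∀ x, u x = ((∫ y, k (x - y) * Φ y : ℝ) : ℂ) := fun x ↦ by
    rw [← integral_complex_ofReal]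
    simp only [u, Complex.ofReal_mul]
    rw [convolution_mul_swap]
  have hwq : MemLp (fun ξ ↦ q ξ • (κ ξ * v ξ)) 2 := by
    have h1 : MemLp (fun ξ ↦ m ξ * hw₁s.toLp _ ξ) 2 volume := memLp_bdd_mul hm hmC _
    refine (memLp_congr_ae ?_).1 h1
    filter_upwards [hw₁s.coeFn_toLp] with ξ h1
    rw [h1]
    simp only [m, Complex.real_smul]
    push_cast
    have : (q ξ : ℂ) ≠ 0 := by exact_mod_cast hq0 ξ
    field_simp
  have hw₂ : MemLp (fun ξ ↦ κ ξ * v ξ) 2 := by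
    refine hwq.of_le (by fun_prop) (.of_forall fun ξ ↦ ?_)
    rw [norm_smul, Real.norm_of_nonneg (by linarith [hq1 ξ])]
    exact le_mul_of_one_le_left (norm_nonneg _) (hq1 ξ)
  have hinv : (𝓕⁻ (hw₂.toLp _) : Lp ℂ 2 (volume : Measure (Space d))) =ᵐ[volume] u := by
    refine ae_eq_of_fourier_ae_eq hu ?_
    rw [FourierTransform.fourier_fourierInv_eq]
    filter_upwards [hw₂.coeFn_toLp] with ξ h1
    rw [h1, Real.fourier_mul_convolution_eq hk hΦC1]
  obtain ⟨F₂, hF₂, hF₂u⟩ := exists_sobolevSpace_of_spectrum (s := s) hw₂ hwq (by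
    filter_upwards [hinv] with x hx
    rw [hx, hureal, Complex.ofReal_im])
  have hA : A F₁ = F₂ := by
    have h1 : mulL2 m C hm hmC (W F₁) = W F₂ := by
      change mulL2 m C hm hmC (SobolevSpace.toWeighted d s F₁) = SobolevSpace.toWeighted d s F₂
      refine Lp.ext ?_
      filter_upwards [coeFn_mulL2 hm hmC (SobolevSpace.toWeighted d s F₁), hF₁', hF₂]
        with ξ h1 h2 h3
      rw [h1, h2, h3]
      change m ξ * _ = q ξ • _
      simp only [m, Complex.real_smul]
      push_cast
      have : (q ξ : ℂ) ≠ 0 := by exact_mod_cast hq0 ξ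
      field_simp
    refine ext_inner_right ℝ fun g ↦ ?_
    change inner ℝ ((ContinuousLinearMap.adjoint W.toContinuousLinearMap)
      (mulL2 m C hm hmC (W F₁))) g = _
    rw [ContinuousLinearMap.adjoint_inner_left, h1]
    exact W.inner_map_map F₂ g
  change SobolevOn.toL2 D s ((vanishingOn D s).mkQL (A (rieszRepr D s (L2ToDual D s φ)))) =ᵐ[_] _
  rw [hrep, hA, SobolevOn.toL2_mk]
  filter_upwards [coeFn_sobolevRestrict (D := D) F₂, ae_restrict_of_ae hF₂u,
    ae_restrict_of_ae hinv, ae_restrict_mem hDm] with z h1 h2 h3 hz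
  rw [h1]
  rw [h3, hureal, Complex.ofReal_inj] at h2
  rw [h2, potential, ← integral_indicator hDm]
  refine integral_congr_ae (.of_forall fun y ↦ ?_)
  by_cases hy : y ∈ (D : Set (Space d))
  · simp only [Φ, Set.indicator_of_mem hy, hkD z hz y hy]
  · simp [Φ, hy]

end PotentialOperator

/-! ### Coercive operators from a dual space -/

/-- A coercive operator from the dual of a normed space to the space is bijective: coercivity makes
it bounded below, and a functional vanishing on its range vanishes when tested on its own image. -/
theorem bijective_of_coercive {V : Type*} [NormedAddCommGroup V] [NormedSpace ℝ V]
    (T : StrongDual ℝ V →L[ℝ] V) {c : ℝ} (hc : 0 < c)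
    (hT : ∀ ℓ : StrongDual ℝ V, c * ‖ℓ‖ ^ 2 ≤ ℓ (T ℓ)) :
    Function.Bijective T := by
  have hbelow : ∀ ℓ : StrongDual ℝ V, ‖ℓ‖ ≤ (⟨c⁻¹, by positivity⟩ : ℝ≥0) * ‖T ℓ‖ := fun ℓ ↦ by
    have h1 : c * ‖ℓ‖ ^ 2 ≤ ‖ℓ‖ * ‖T ℓ‖ :=
      (hT ℓ).trans ((le_abs_self _).trans (ℓ.le_opNorm _))
    change ‖ℓ‖ ≤ c⁻¹ * ‖T ℓ‖
    rw [inv_mul_eq_div, le_div_iff₀ hc]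
    rcases (norm_nonneg ℓ).eq_or_lt with h0 | h0
    · rw [← h0, zero_mul]
      exact norm_nonneg _
    · nlinarith
  have hanti : AntilipschitzWith _ T := T.antilipschitz_of_bound hbelow
  refine ⟨hanti.injective, ?_⟩
  have hclosed : IsClosed (Set.range T) := hanti.isClosed_range T.uniformContinuous
  by_contra hsurj
  obtain ⟨v, hv⟩ := not_forall.1 hsurj
  obtain ⟨ℓ, a, ha, hav⟩ := geometric_hahn_banach_closed_point
    (s := Set.range T) (LinearMap.range T.toLinearMap).convex hclosed (fun ⟨ℓ, hℓ⟩ ↦ hv ⟨ℓ, hℓ⟩)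
  have hℓ : ℓ ≠ 0 := fun h0 ↦ by
    have := ha _ ⟨0, rfl⟩
    rw [h0] at this hav
    exact lt_asymm this hav
  have hp : 0 < ℓ (T ℓ) := lt_of_lt_of_le (by have := norm_pos_iff.2 hℓ; positivity) (hT ℓ)
  -- A linear functional bounded above on a subspace has to vanish there.
  have h1 := ha _ ⟨(a / ℓ (T ℓ)) • ℓ, rfl⟩
  rw [map_smul, map_smul, smul_eq_mul, div_mul_cancel₀ _ hp.ne'] at h1
  exact lt_irrefl _ h1

/-! ### The bijective extension of the potential operator -/

theorem IsNonDegenerate.exists_le_of_sq_eq {d : ℕ} {D : Opens (Space d)} {h : Space d → ℝ}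
    {β α : ℝ} (hnd : IsNonDegenerate D h β) (hβ : β ^ 2 = α) :
    ∃ c₀ : ℝ, 0 < c₀ ∧ ∀ ψ : 𝓓(D, ℝ),
      c₀ * ‖L2ToDual D (sobolevOrder d α) (testToL2 D ψ)‖ ^ 2 ≤
        ∫ z in (D : Set (Space d)), ψ z * potential D h α ψ z := by
  subst hβ
  exact hnd

theorem lemma5p5 {d : ℕ} (D : Opens (Space d)) (hD : IsSmoothBoundedDomain D)
    {Ω : Type*} [MeasurableSpace Ω] (P : Measure Ω) [IsProbabilityMeasure P]
    (X : Ω → 𝓓'(D, ℝ)) (h : Space d → ℝ) (hX : IsLogCorrelatedField D P X h)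
    (α : ℝ) (hα : 0 < α) (hαd : α < d) (hnd : IsNonDegenerate D h (Real.sqrt α)) :
    ∃ T : SobolevDual D (sobolevOrder d α) →L[ℝ] SobolevOn D (sobolevOrder d α),
      Function.Bijective T ∧
      (∀ φ : Lp ℝ 2 (volume.restrict (D : Set (Space d))),
        (SobolevOn.toL2 D (sobolevOrder d α) (T (L2ToDual D (sobolevOrder d α) φ)) : Space d → ℝ)
          =ᵐ[volume.restrict (D : Set (Space d))] potential D h α φ) ∧
      (∀ T' : SobolevDual D (sobolevOrder d α) →L[ℝ] SobolevOn D (sobolevOrder d α),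
        (∀ ψ : 𝓓(D, ℝ),
          (SobolevOn.toL2 D (sobolevOrder d α) (T' (L2ToDual D (sobolevOrder d α) (testToL2 D ψ)))
              : Space d → ℝ)
            =ᵐ[volume.restrict (D : Set (Space d))] potential D h α ψ) → T' = T) := by
  set s := sobolevOrder d α
  obtain ⟨T, hT⟩ := exists_potentialOperator hD.isBounded hX.smooth hα hαd
  have htest : ∀ ψ : 𝓓(D, ℝ), (SobolevOn.toL2 D s (T (L2ToDual D s (testToL2 D ψ))) : Space d → ℝ)
      =ᵐ[volume.restrict (D : Set (Space d))] potential D h α ψ := fun ψ ↦ by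
    refine (hT (testToL2 D ψ)).trans (.of_forall fun z ↦ integral_congr_ae ?_)
    filter_upwards [coeFn_testToL2 ψ] with y hy
    rw [hy]
  refine ⟨T, ?_, hT, fun T' hT' ↦ ?_⟩
  · obtain ⟨c₀, hc₀, hc⟩ := hnd.exists_le_of_sq_eq (Real.sq_sqrt hα.le)
    refine bijective_of_coercive T hc₀ fun ℓ ↦ ?_
    refine denseRange_testToDual.induction_on ℓ (isClosed_le (by fun_prop) ?_) fun ψ ↦ ?_
    · exact isBoundedBilinearMap_apply.continuous.comp (continuous_id.prodMk T.continuous)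
    · refine (hc ψ).trans (le_of_eq ?_)
      rw [testToDual_apply, L2ToDual_apply]
      refine integral_congr_ae ?_
      filter_upwards [htest ψ, coeFn_testToL2 ψ] with z h1 h2
      rw [h1, h2]
  · refine ContinuousLinearMap.ext fun ℓ ↦ ?_
    refine denseRange_testToDual.induction_on ℓ (isClosed_eq T'.continuous T.continuous) fun ψ ↦ ?_
    exact SobolevOn.toL2_injective (Lp.ext ((hT' ψ).trans (htest ψ).symm))
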